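/- Let $\Gamma$ be a finite oriented graph with vertex set $V$ and edge set $E$ (multiple edges and edges from a vertex to itself are allowed); an edge $e\in E$ starts at $s_e$ and ends at $t_e$, and $e^{-1}$ denotes the reversed edge, so $s_{e^{-1}}=t_e$ and $t_{e^{-1}}=s_e$. Assign spinors $z_e,z_{e^{-1}}\in\mathbb{C}^2$ to every $e\in E$, write $\tilde z_e=z_{e^{-1}}$ (so $\tilde z_{e^{-1}}=z_e$), and $[z|w\rangle=z^0w^1-z^1w^0$. For spins $j_e\in\{0,\tfrac12,1,\dots\}$ put $J_v=\sum_{e:s_e=v}j_e+\sum_{e:t_e=v}j_e$ and $$A_\Gamma(j_e,z_e)=\int_{SU(2)^{V}}\prod_{v\in V}dg_v\prod_{e\in E}\frac{[z_e|g_{s_e}g_{t_e}^{-1}|z_{e^{-1}}\rangle^{2j_e}}{(2j_e)!},$$ with $dg$ the normalized Haar measure. The generating functional is $$\mathcal{A}_\Gamma(z_e)=\sum_{(j_e)_{e\in E}}\ \prod_{v\in V}(J_v+1)!\;A_\Gamma(j_e,z_e),\qquad (J_v+1)!:=\Gamma(J_v+2).$$ A non-trivial cycle of $\Gamma$ is a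 sequence $c=(e_1,\dots,e_n)$, $n\ge1$, of edges and reversed edges with $t_{e_i}=s_{e_{i+1}}$ for $i<n$ and $t_{e_n}=s_{e_1}$, in which no edge of $\Gamma$ occurs twice (in either direction) and the vertices $s_{e_1},\dots,s_{e_n}$ are pairwise distinct; sequences that differ only by the starting point or by the direction of traversal are the same cycle. Put $$A_c(z_e)=-(-1)^{|e|}\,[\tilde z_{e_1}|z_{e_2}\rangle[\tilde z_{e_2}|z_{e_3}\rangle\cdots[\tilde z_{e_n}|z_{e_1}\rangle,$$ where $|e|$ is the number of edges of $c$ traversed along the orientation of $\Gamma$; this does not depend on the traversal. A disjoint cycle union is a non-empty set $C=\{c_1,\dots,c_k\}$ of non-trivial cycles that pairwise have no common edge or vertex, and $A_C=A_{c_1}\cdots A_{c_k}$. Let $D(z)=1+\sum_C A_C(z_e)$, the sum being over all disjoint cycle unions of $\Gamma$. Then $$\mathcal{A}_\Gamma(z_e)=\frac{1}{\bigl(1+\sum_C A_C(z_e)\bigr)^2}$$ in the following sense. The series defining $\mathcal{A}_\Gamma$ converges absolutely for all spinors of sufficiently small norm. Whenever it converges absolutely, $D(z)\neq0$ and its sum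 is $1/D(z)^2$. Moreover, if $F$ is analytic on a connected open set $U$ of spinor data containing $0$ and agrees with $\mathcal{A}_\Gamma$ near $0$, then $D\neq0$ on $U$ and $F=1/D^2$ on $U$. -/

import Mathlib

open MeasureTheory

noncomputable section

namespace SpinNetwork

/-! ## Spinors and the group `SU(2)` -/

/-- A spinor `|z⟩`: a vector of `ℂ²`. -/
abbrev Spinor : Type := Fin 2 → ℂ

/-- The holomorphic invariant `[z|w⟩ = z⁰ w¹ - z¹ w⁰`. -/
def bracket (z w : Spinor) : ℂ := z 0 * w 1 - z 1 * w 0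

/-- The group `SU(2)` of unitary `2 × 2` matrices of determinant one. -/
abbrev SU2 : Type := Matrix.specialUnitaryGroup (Fin 2) ℂ

/-- `[z|g|w⟩`, where `g ∈ SU(2)` acts on spinors by its defining representation. -/
def bracketAct (z : Spinor) (g : SU2) (w : Spinor) : ℂ :=
  bracket z (Matrix.mulVec (g : Matrix (Fin 2) (Fin 2) ℂ) w)

instance : IsTopologicalGroup SU2 where
  continuous_inv := by
    have h : Continuous fun g : SU2 => star (g : Matrix (Fin 2) (Fin 2) ℂ) :=
      Continuous.star continuous_subtype_val
    exact h.subtype_mk _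

instance : CompactSpace SU2 := by
  have hb : IsCompact (Set.pi Set.univ fun _ : Fin 2 => Set.pi Set.univ fun _ : Fin 2 =>
      Metric.closedBall (0 : ℂ) 1) :=
    isCompact_univ_pi fun _ => isCompact_univ_pi fun _ => isCompact_closedBall 0 1
  refine isCompact_iff_compactSpace.mp (IsCompact.of_isClosed_subset
    (s := (Set.pi Set.univ fun _ : Fin 2 => Set.pi Set.univ fun _ : Fin 2 =>
      Metric.closedBall (0 : ℂ) 1 : Set (Matrix (Fin 2) (Fin 2) ℂ))) hb ?_ ?_)
  · have h : ((Matrix.specialUnitaryGroup (Fin 2) ℂ : Submonoid _) :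
        Set (Matrix (Fin 2) (Fin 2) ℂ)) = {A | A * star A = 1} ∩ {A | A.det = 1} := by
      ext A
      simp [Matrix.mem_specialUnitaryGroup_iff, Matrix.mem_unitaryGroup_iff]
    rw [h]
    refine IsClosed.inter (isClosed_eq ?_ continuous_const) (isClosed_eq ?_ continuous_const)
    · exact (continuous_id (X := Matrix (Fin 2) (Fin 2) ℂ)).mul continuous_id.star
    · exact (continuous_id (X := Matrix (Fin 2) (Fin 2) ℂ)).matrix_det
  · intro A hA i _ j _
    have := entry_norm_bound_of_unitary (Matrix.specialUnitaryGroup_le_unitaryGroup hA) i j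
    simpa using this

instance : MeasurableSpace SU2 := borel SU2

instance : BorelSpace SU2 := ⟨rfl⟩

/-- The normalized Haar measure of `SU(2)`. -/
def haarSU2 : Measure SU2 := Measure.haarMeasure ⊤

/-! ## Oriented graphs, spins and the coherent amplitude -/

/-- An oriented graph with vertex set `V` and edge set `E`: every edge has a starting and a
terminal vertex. Several edges between two vertices, and edges from a vertex to itself, are
allowed. -/
structure OrientedGraph (V E : Type*) where
  src : E → V
  tgt : E → V

/-- The edges of the graph together with the reversed edges: `(e, true)` is `e`, traversed along
the orientation of the graph, and `(e, false)` is the reverse edge `e⁻¹`. -/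
abbrev DirEdge (E : Type*) : Type _ := E × Bool

/-- The reverse `d⁻¹` of a directed edge. -/
def DirEdge.rev {E : Type*} (d : DirEdge E) : DirEdge E := (d.1, !d.2)

/-- Spinor data on a graph: a spinor `z_d` for every directed edge, that is two spinors `z_e` and
`z_{e⁻¹}` for every edge `e` of the graph. -/
abbrev SpinorData (E : Type*) : Type _ := DirEdge E → Spinor

namespace OrientedGraph

variable {V E : Type*}

/-- The starting vertex of a directed edge. -/
def start (Γ : OrientedGraph V E) (d : DirEdge E) : V := if d.2 then Γ.src d.1 else Γ.tgt d.1

/-- The terminal vertex of a directed edge. -/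
def finish (Γ : OrientedGraph V E) (d : DirEdge E) : V := if d.2 then Γ.tgt d.1 else Γ.src d.1

open Classical in
/-- The sum of spins `J_v = ∑_{e : s_e = v} j_e + ∑_{e : t_e = v} j_e` at a vertex. The spins
`j_e ∈ {0, 1/2, 1, …}` are given by the natural numbers `n_e = 2 j_e`. -/
def spinSum [Fintype E] (Γ : OrientedGraph V E) (n : E → ℕ) (v : V) : ℝ :=
  (∑ e with Γ.src e = v, (n e : ℝ) / 2) + ∑ e with Γ.tgt e = v, (n e : ℝ) / 2

/-- The coherent amplitude
`A_Γ(j_e, z_e) = ∫ ∏_v dg_v ∏_e [z_e| g_{s_e} g_{t_e}⁻¹ |z_{e⁻¹}⟩^{2 j_e} / (2 j_e)!`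
with `2 j_e = n_e`. -/
def amplitude [Fintype V] [Fintype E] (Γ : OrientedGraph V E) (n : E → ℕ) (z : SpinorData E) : ℂ :=
  ∫ g : V → SU2,
    ∏ e, bracketAct (z (e, true)) (g (Γ.src e) * (g (Γ.tgt e))⁻¹) (z (e, false)) ^ n e
      / ((n e).factorial : ℂ)
    ∂(Measure.pi fun _ : V => haarSU2)

/-- The term `∏_v (J_v + 1)! A_Γ(j_e, z_e)` of the generating functional, with
`(J_v + 1)! = Γ(J_v + 2)`. -/
def genTerm [Fintype V] [Fintype E] (Γ : OrientedGraph V E) (z : SpinorData E) (n : E → ℕ) : ℂ :=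
  (∏ v, (Real.Gamma (Γ.spinSum n v + 2) : ℂ)) * Γ.amplitude n z

/-- The generating functional `𝒜_Γ(z_e) = ∑_{j_e} ∏_v (J_v + 1)! A_Γ(j_e, z_e)`; the sum is over
all assignments of spins to the edges. -/
def genFunctional [Fintype V] [Fintype E] (Γ : OrientedGraph V E) (z : SpinorData E) : ℂ :=
  ∑' n : E → ℕ, Γ.genTerm z n

/-! ## Non-trivial cycles -/

/-- A list `e₁, …, eₙ` (`n ≥ 1`) of directed edges is a cyclic traversal of a non-trivial cycle if
`t_{e_i} = s_{e_{i+1}}` cyclically, no edge of the graph is used twice (in whatever direction), and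
the vertices `s_{e_i}` are pairwise distinct. -/
structure IsCycleList (Γ : OrientedGraph V E) (l : List (DirEdge E)) : Prop where
  ne_nil : l ≠ []
  closed : l.map Γ.finish = (l.map Γ.start).rotate 1
  edges_nodup : (l.map Prod.fst).Nodup
  starts_nodup : (l.map Γ.start).Nodup

/-- The same path traversed backwards: `(e₁, …, eₙ) ↦ (eₙ⁻¹, …, e₁⁻¹)`. -/
def revList (l : List (DirEdge E)) : List (DirEdge E) := (l.map DirEdge.rev).reverse

/-- Two traversals describe the same cycle if they agree up to the choice of the starting point and
of the direction in which the cycle is traversed. -/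
def SameCycle (l l' : List (DirEdge E)) : Prop := l ~r l' ∨ revList l ~r l'

theorem revList_revList (l : List (DirEdge E)) : revList (revList l) = l := by
  simp [revList, List.map_reverse, Function.comp_def, DirEdge.rev]

theorem revList_isRotated {l l' : List (DirEdge E)} (h : l ~r l') : revList l ~r revList l' :=
  (h.map _).reverse

theorem sameCycle_refl (l : List (DirEdge E)) : SameCycle l l := Or.inl (List.IsRotated.refl l)

theorem sameCycle_symm {l l' : List (DirEdge E)} (h : SameCycle l l') : SameCycle l' l := by
  rcases h with h | h
  · exact Or.inl h.symm
  · right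
    have := revList_isRotated h
    rw [revList_revList] at this
    exact this.symm

theorem sameCycle_trans {l l' l'' : List (DirEdge E)} (h : SameCycle l l')
    (h' : SameCycle l' l'') : SameCycle l l'' := by
  rcases h with h | h <;> rcases h' with h' | h'
  · exact Or.inl (h.trans h')
  · exact Or.inr ((revList_isRotated h).trans h')
  · exact Or.inr (h.trans h')
  · left
    have := revList_isRotated h
    rw [revList_revList] at this
    exact this.trans h'

/-- Traversals of non-trivial cycles, up to starting point and direction. -/
instance cycleSetoid (Γ : OrientedGraph V E) : Setoid {l : List (DirEdge E) // Γ.IsCycleList l} where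
  r l l' := SameCycle l.1 l'.1
  iseqv := ⟨fun l => sameCycle_refl l.1, sameCycle_symm, sameCycle_trans⟩

/-- The non-trivial cycles of a graph. -/
def NontrivialCycle (Γ : OrientedGraph V E) : Type _ := Quotient Γ.cycleSetoid

/-- The quantity `-(-1)^{|e|} [z̃_{e₁}|z_{e₂}⟩ [z̃_{e₂}|z_{e₃}⟩ ⋯ [z̃_{eₙ}|z_{e₁}⟩` of a traversal,
where `|e|` is the number of edges that are traversed along the orientation of the graph and
`z̃_e = z_{e⁻¹}`. -/
def listAmp (z : SpinorData E) (l : List (DirEdge E)) : ℂ :=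
  -(-1) ^ (l.countP fun d => d.2) *
    (List.zipWith (fun d d' => bracket (z d.rev) (z d')) l (l.rotate 1)).prod

theorem listAmp_rotate (z : SpinorData E) (l : List (DirEdge E)) (k : ℕ) :
    listAmp z (l.rotate k) = listAmp z l := by
  unfold listAmp
  rw [List.rotate_rotate, add_comm k 1, ← List.rotate_rotate,
    ← List.zipWith_rotate_distrib _ _ _ _ (by simp),
    (List.rotate_perm l k).countP_eq, (List.rotate_perm _ k).prod_eq]

theorem bracket_swap (z w : Spinor) : bracket z w = -bracket w z := by
  unfold bracket; ring

theorem prod_zipWith_bracket_swap (z : SpinorData E) (l l' : List (DirEdge E)) :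
    (List.zipWith (fun d d' => bracket (z d') (z d.rev)) l l').prod =
      (-1) ^ (min l.length l'.length) *
        (List.zipWith (fun d d' => bracket (z d.rev) (z d')) l l').prod := by
  induction l generalizing l' with
  | nil => simp
  | cons a l ih =>
    cases l' with
    | nil => simp
    | cons b l' =>
      simp only [List.zipWith_cons_cons, List.prod_cons, List.length_cons, ih,
        Nat.succ_min_succ, pow_succ, bracket_swap (z b) (z a.rev)]
      ring

theorem countP_revList (l : List (DirEdge E)) :
    (revList l).countP (fun d => d.2) + l.countP (fun d => d.2) = l.length := by
  rw [revList, List.countP_reverse, List.countP_map, add_comm,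
    List.length_eq_countP_add_countP (fun d : DirEdge E => d.2)]
  congr 1
  apply List.countP_congr
  intro d _
  simp [DirEdge.rev]

theorem prod_zipWith_revList (z : SpinorData E) (l : List (DirEdge E)) :
    (List.zipWith (fun d d' => bracket (z d.rev) (z d')) (revList l) ((revList l).rotate 1)).prod =
      (List.zipWith (fun d d' => bracket (z d') (z d.rev)) l (l.rotate 1)).prod := by
  have hrot : (l.rotate 1).rotate (l.length - 1 % l.length) = l := by
    rcases l with _ | ⟨a, _ | ⟨b, t⟩⟩
    · simp
    · simp
    · rw [List.rotate_rotate, Nat.mod_eq_of_lt (by simp), Nat.add_sub_cancel' (by simp),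
        List.rotate_length]
  have hf : ∀ d d' : DirEdge E,
      bracket (z (DirEdge.rev (DirEdge.rev d))) (z (DirEdge.rev d')) =
        bracket (z d) (z d'.rev) := by
    intro d d'; simp [DirEdge.rev]
  have hlen : (l.map DirEdge.rev).length = l.length := List.length_map _
  set k := l.length - 1 % l.length with hk
  rw [revList, List.rotate_reverse, hlen, ← hk, ← List.reverse_zipWith (by simp),
    (List.reverse_perm _).prod_eq, ← List.map_rotate]
  rw [List.zipWith_map]
  simp only [hf]
  rw [← (List.rotate_perm _ 1).prod_eq, List.zipWith_rotate_distrib _ _ _ _ (by simp),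
    List.rotate_rotate, add_comm k 1, ← List.rotate_rotate, hrot, List.zipWith_comm]

theorem listAmp_revList (z : SpinorData E) (l : List (DirEdge E)) :
    listAmp z (revList l) = listAmp z l := by
  unfold listAmp
  rw [prod_zipWith_revList, prod_zipWith_bracket_swap, List.length_rotate, min_self,
    ← countP_revList l, pow_add, ← mul_assoc, neg_mul, ← mul_assoc, ← pow_add, ← two_mul, pow_mul]
  simp

theorem listAmp_sameCycle (z : SpinorData E) {l l' : List (DirEdge E)} (h : SameCycle l l') :
    listAmp z l = listAmp z l' := by
  rcases h with ⟨k, hk⟩ | ⟨k, hk⟩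
  · rw [← hk, listAmp_rotate]
  · rw [← hk, listAmp_rotate, listAmp_revList]

/-- The amplitude `A_c(z_e)` of a non-trivial cycle. -/
def cycleAmp {Γ : OrientedGraph V E} (z : SpinorData E) (c : Γ.NontrivialCycle) : ℂ :=
  Quotient.lift (fun l : {l : List (DirEdge E) // Γ.IsCycleList l} => listAmp z l.1)
    (fun _ _ h => listAmp_sameCycle z h) c

/-- The edges of the graph that a traversal uses. -/
def listEdges (l : List (DirEdge E)) : Set E := {e | ∃ d ∈ l, d.1 = e}

/-- The vertices that a traversal meets. -/
def listVerts (Γ : OrientedGraph V E) (l : List (DirEdge E)) : Set V :=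
  {v | ∃ d ∈ l, Γ.start d = v ∨ Γ.finish d = v}

theorem listEdges_sameCycle {l l' : List (DirEdge E)} (h : SameCycle l l') :
    listEdges l = listEdges l' := by
  ext e
  rcases h with h | h
  · simp only [listEdges, Set.mem_ofPred_eq, h.mem_iff]
  · simp only [listEdges, Set.mem_ofPred_eq, ← h.mem_iff]
    simp [revList, DirEdge.rev, or_comm]

theorem listVerts_sameCycle (Γ : OrientedGraph V E) {l l' : List (DirEdge E)}
    (h : SameCycle l l') : Γ.listVerts l = Γ.listVerts l' := by
  ext v
  rcases h with h | h
  · simp only [listVerts, Set.mem_ofPred_eq, h.mem_iff]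
  · simp only [listVerts, Set.mem_ofPred_eq, ← h.mem_iff]
    simp [revList, DirEdge.rev, start, finish, or_comm]

/-- The set of edges of a non-trivial cycle. -/
def NontrivialCycle.edges {Γ : OrientedGraph V E} (c : Γ.NontrivialCycle) : Set E :=
  Quotient.lift (fun l : {l : List (DirEdge E) // Γ.IsCycleList l} => listEdges l.1)
    (fun _ _ h => listEdges_sameCycle h) c

/-- The set of vertices of a non-trivial cycle. -/
def NontrivialCycle.verts {Γ : OrientedGraph V E} (c : Γ.NontrivialCycle) : Set V :=
  Quotient.lift (fun l : {l : List (DirEdge E) // Γ.IsCycleList l} => Γ.listVerts l.1)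
    (fun _ _ h => Γ.listVerts_sameCycle h) c

instance [Finite E] (Γ : OrientedGraph V E) : Finite Γ.NontrivialCycle := by
  have := Fintype.ofFinite E
  have hfin : {l : List (DirEdge E) | l.length ≤ Fintype.card E}.Finite :=
    List.finite_length_le _ _
  have : Finite {l : List (DirEdge E) // Γ.IsCycleList l} := by
    refine (hfin.subset ?_).to_subtype
    intro l hl
    simpa using hl.edges_nodup.length_le_card
  exact Quotient.finite _

instance [Finite E] (Γ : OrientedGraph V E) : Fintype Γ.NontrivialCycle := Fintype.ofFinite _

/-! ## Disjoint cycle unions -/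

/-- A disjoint cycle union: a non-empty collection of non-trivial cycles that pairwise have no
edges and no vertices in common. -/
def IsDisjointCycleUnion {Γ : OrientedGraph V E} (C : Finset Γ.NontrivialCycle) : Prop :=
  C.Nonempty ∧ ∀ c ∈ C, ∀ c' ∈ C, c ≠ c' → Disjoint c.edges c'.edges ∧ Disjoint c.verts c'.verts

/-- The amplitude `A_C(z_e) = A_{c₁}(z_e) ⋯ A_{c_k}(z_e)` of a collection of cycles. -/
def unionAmp {Γ : OrientedGraph V E} (z : SpinorData E) (C : Finset Γ.NontrivialCycle) : ℂ :=
  ∏ c ∈ C, cycleAmp z c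

open Classical in
/-- The polynomial `1 + ∑_C A_C(z_e)`; the sum is over all disjoint cycle unions `C`. -/
def cyclePoly [Finite E] (Γ : OrientedGraph V E) (z : SpinorData E) : ℂ :=
  1 + ∑ C : Finset Γ.NontrivialCycle with IsDisjointCycleUnion C, unionAmp z C

end OrientedGraph

end SpinNetwork

end

/-! ### Gaussian integrals over `ι → ℂ` and determinants. -/

noncomputable section

/-! The factor `(J_v + 1)!` is what turns Haar integrals into Gaussian ones. Writing a spinor as
`x_v = |x_v| g_v e₀` with `g_v ∈ SU(2)`, a function homogeneous of degree `2 J_v` in each `x_v` has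
Gaussian integral `∏ π² Γ(J_v + 2)` times its Haar average (`integral_homogeneous_mul_exp`). So each
term of the series is, up to `π ^ (2|V|)`, a Gaussian integral of `∏ Q_e ^ n_e / n_e!`, where `Q_e`
is quadratic (`genTerm_eq_integral`). Summing under the integral gives `∫ exp(-|x|² + x†Kx)`, hence
`1 / det(1 - K)` for small spinors (`IsSmall.hasSum_genTerm`), where `K` has size `2|V|`.

It remains to see that `det(1 - K) = D²` (`IsSmall.cyclePoly_sq`). The matrix `K` is self-adjoint
for the symplectic form on each `ℂ²`, because reversing an edge only changes a sign. A self-adjoint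
`2 × 2` block is scalar, so eliminating the vertices one by one multiplies the determinant by the
square of a scalar pivot (`det_insert`). The cycle sums `D_S` over vertex subsets obey the same
recursion with the pivot itself (`cyclePolyOn_insert_eq_pivot_mul`). For this, the cycles through
the new vertex are opened into paths, and path sums, weighted by the cycle unions avoiding the path,
are `D_S` times matrix elements of a resolvent (`pathSum_eq_sandwich`). Each cycle is counted in two
directions, which matches the trace of a scalar `2 × 2` block.

Finally, the identity `𝒜 · D² = 1` is polynomial in `D`, so it extends analytically without knowing
where `D` vanishes, and then forces `D ≠ 0`. Under absolute convergence it is carried along the disc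
`t ↦ t • z` to its boundary point `t = 1`. -/

theorem Complex.measurePreserving_mulVec {ι : Type*} [Fintype ι] [DecidableEq ι]
    (B : Matrix ι ι ℂ) (hB : ‖B.det‖ = 1) :
    MeasurePreserving (fun x : ι → ℂ => B.mulVec x) := by
  -- The real Jacobian of a complex-linear map is the norm from `ℂ` to `ℝ` of its determinant, that
  -- is `‖det‖ ^ 2`.
  have h0 : LinearMap.det ((Matrix.toLin' B).restrictScalars ℝ) = 1 := by
    rw [LinearMap.det_restrictScalars, LinearMap.det_toLin', Algebra.norm_complex_eq]
    simp [Complex.normSq_eq_norm_sq, hB]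
  refine ⟨(Matrix.toLin' B).continuous_of_finiteDimensional.measurable, ?_⟩
  have := Measure.map_linearMap_addHaar_eq_smul_addHaar (μ := (volume : Measure (ι → ℂ)))
    (f := (Matrix.toLin' B).restrictScalars ℝ) (by rw [h0]; exact one_ne_zero)
  rw [h0] at this
  have h2 : Measure.map (fun x : ι → ℂ => B.mulVec x) volume
    = ENNReal.ofReal |(1 : ℝ)⁻¹| • (volume : Measure (ι → ℂ)) := this
  simpa using h2

theorem integral_comp_mulVec {ι F : Type*} [Fintype ι] [DecidableEq ι]
    [NormedAddCommGroup F] [NormedSpace ℝ F]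
    (B : Matrix ι ι ℂ) (hB : B.det ≠ 0) (f : (ι → ℂ) → F) :
    ∫ x, f (B.mulVec x) = (‖B.det‖ ^ 2)⁻¹ • ∫ x, f x := by
  have h0 : LinearMap.det ((Matrix.toLin' B).restrictScalars ℝ) = ‖B.det‖ ^ 2 := by
    rw [LinearMap.det_restrictScalars, LinearMap.det_toLin', Algebra.norm_complex_eq]
    simp [Complex.normSq_eq_norm_sq]
  have := Measure.map_linearMap_addHaar_eq_smul_addHaar (μ := (volume : Measure (ι → ℂ)))
    (f := (Matrix.toLin' B).restrictScalars ℝ) (by rw [h0]; positivity)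
  rw [h0] at this
  let e : (ι → ℂ) ≃ₗ[ℂ] (ι → ℂ) := Matrix.toLinearEquiv' B (Matrix.invertibleOfIsUnitDet B hB.isUnit)
  have he : ∀ x, e x = B.mulVec x := fun x => rfl
  have hme : MeasurableEmbedding (fun x : ι → ℂ => B.mulVec x) :=
    e.toContinuousLinearEquiv.toHomeomorph.measurableEmbedding
  rw [← hme.integral_map]
  have h2 : Measure.map (fun x : ι → ℂ => B.mulVec x) volume
    = ENNReal.ofReal |(‖B.det‖ ^ 2)⁻¹| • (volume : Measure (ι → ℂ)) := this
  rw [h2, integral_smul_measure, ENNReal.toReal_ofReal (abs_nonneg _), abs_of_nonneg (by positivity)]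

theorem integral_exp_neg_sum_norm_sq (ι : Type*) [Fintype ι] :
    ∫ x : ι → ℂ, Real.exp (-∑ i, ‖x i‖ ^ 2) = Real.pi ^ Fintype.card ι := by
  have h := GaussianFourier.integral_rexp_neg_mul_sq_norm (V := ℂ) (b := 1) one_pos
  simp only [← Finset.sum_neg_distrib, Real.exp_sum]
  rw [integral_fintype_prod_volume_eq_pow (fun z : ℂ => Real.exp (-‖z‖ ^ 2))]
  norm_num at h
  rw [h]

theorem integrable_exp_neg_sum_norm_sq (ι : Type*) [Fintype ι] {c : ℝ} (hc : 0 < c) :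
    Integrable fun x : ι → ℂ => Real.exp (-(c * ∑ i, ‖x i‖ ^ 2)) := by
  have h := GaussianFourier.integrable_cexp_neg_mul_sq_norm_add (V := ℂ) (b := (c : ℂ)) (by simpa) 0 0
  have h1 : Integrable fun z : ℂ => Real.exp (-(c * ‖z‖ ^ 2)) := by
    refine h.re.congr (Filter.Eventually.of_forall fun z => ?_)
    have : (-(c : ℂ) * ‖z‖ ^ 2 + 0 * (inner ℝ 0 z : ℝ)) = ((-(c * ‖z‖ ^ 2) : ℝ) : ℂ) := by
      push_cast; ring
    simp only [this]
    exact Complex.exp_ofReal_re _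
  have := Integrable.fintype_prod (ι := ι) (f := fun _ (z : ℂ) => Real.exp (-(c * ‖z‖ ^ 2))) fun _ => h1
  refine this.congr (Filter.Eventually.of_forall fun x => ?_)
  simp only [Finset.mul_sum, ← Finset.sum_neg_distrib, Real.exp_sum]

/-- The sesquilinear form `x ↦ x† K x`. -/
def hermForm {ι : Type*} [Fintype ι] (K : Matrix ι ι ℂ) (x : ι → ℂ) : ℂ :=
  star x ⬝ᵥ K.mulVec x

section
variable {ι : Type*} [Fintype ι]

theorem hermForm_one [DecidableEq ι] (x : ι → ℂ) : hermForm 1 x = ((∑ i, ‖x i‖ ^ 2 : ℝ) : ℂ) := by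
  simp only [hermForm, Matrix.one_mulVec, dotProduct, Pi.star_apply, RCLike.star_def,
    Complex.conj_mul']
  push_cast; rfl

theorem hermForm_add (A B : Matrix ι ι ℂ) (x : ι → ℂ) :
    hermForm (A + B) x = hermForm A x + hermForm B x := by
  simp [hermForm, Matrix.add_mulVec]

theorem hermForm_sub (A B : Matrix ι ι ℂ) (x : ι → ℂ) :
    hermForm (A - B) x = hermForm A x - hermForm B x := by
  simp [hermForm, Matrix.sub_mulVec]

theorem hermForm_smul (c : ℂ) (B : Matrix ι ι ℂ) (x : ι → ℂ) :
    hermForm (c • B) x = c * hermForm B x := by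
  simp [hermForm, Matrix.smul_mulVec]

theorem hermForm_conjTranspose (A : Matrix ι ι ℂ) (x : ι → ℂ) :
    hermForm A.conjTranspose x = star (hermForm A x) := by
  simp only [hermForm]
  rw [Matrix.star_dotProduct, Matrix.star_mulVec, Matrix.conjTranspose_conjTranspose,
    ← Matrix.dotProduct_mulVec]

theorem continuous_hermForm (A : Matrix ι ι ℂ) : Continuous (hermForm A) := by
  unfold hermForm
  fun_prop

-- Factor `H = B†B` and substitute `y = Bx`: the Jacobian `‖det B‖ ^ 2` equals `det H`.
open scoped ComplexOrder MatrixOrder Matrix.Norms.L2Operator in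
theorem integral_exp_neg_hermForm_of_posDef [DecidableEq ι] {H : Matrix ι ι ℂ} (hH : H.PosDef) :
    ((∫ x, Real.exp (-(hermForm H x).re) : ℝ) : ℂ) * H.det = Real.pi ^ Fintype.card ι := by
  obtain ⟨B, hB⟩ : ∃ B : Matrix ι ι ℂ, H = B.conjTranspose * B := by
    obtain ⟨B, hB⟩ := CStarAlgebra.nonneg_iff_eq_star_mul_self.mp hH.posSemidef.nonneg
    exact ⟨B, hB⟩
  have hdet : H.det = ((‖B.det‖ ^ 2 : ℝ) : ℂ) := by
    rw [hB, Matrix.det_mul, Matrix.det_conjTranspose, RCLike.star_def, Complex.conj_mul']; push_cast; rfl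
  have hB0 : B.det ≠ 0 := by
    intro h
    have := hH.det_pos
    rw [hdet, h] at this
    simp at this
  have hform : ∀ x, (hermForm H x).re = ∑ i, ‖B.mulVec x i‖ ^ 2 := by
    intro x
    have : hermForm H x = hermForm 1 (B.mulVec x) := by
      simp only [hermForm, hB, Matrix.one_mulVec, Matrix.star_mulVec, ← Matrix.dotProduct_mulVec, ← Matrix.mulVec_mulVec]
    rw [this, hermForm_one, Complex.ofReal_re]
  simp only [hform]
  rw [integral_comp_mulVec B hB0 (fun y => Real.exp (-∑ i, ‖y i‖ ^ 2)),
    integral_exp_neg_sum_norm_sq, hdet, ← Complex.ofReal_mul, smul_eq_mul]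
  rw [mul_right_comm, inv_mul_cancel₀ (by positivity), one_mul]
  push_cast; rfl


theorem sum_norm_sq_pos {x : ι → ℂ} (hx : x ≠ 0) : 0 < ∑ i, ‖x i‖ ^ 2 := by
  obtain ⟨i, hi⟩ := Function.ne_iff.mp hx
  exact Finset.sum_pos' (fun _ _ => by positivity) ⟨i, Finset.mem_univ _, by
    have : x i ≠ 0 := hi
    positivity⟩

/-- A kernel vector of `1 - K` would satisfy `x†Kx = |x|²`, which exceeds the bound. -/
theorem det_one_sub_ne_zero_of_hermForm_le [DecidableEq ι] {K : Matrix ι ι ℂ}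
    (hK : ∀ x, ‖hermForm K x‖ ≤ 1 / 2 * ∑ i, ‖x i‖ ^ 2) : (1 - K).det ≠ 0 := by
  intro h
  obtain ⟨x, hx, h0⟩ := Matrix.exists_mulVec_eq_zero_iff.mpr h
  have h1 : hermForm (1 - K) x = 0 := by simp [hermForm, h0]
  rw [hermForm_sub, sub_eq_zero, hermForm_one] at h1
  have h2 := hK x
  rw [← h1, Complex.norm_real, Real.norm_of_nonneg (by positivity)] at h2
  have h3 := sum_norm_sq_pos hx
  linarith

open scoped ComplexOrder in
theorem posDef_one_sub_of_hermForm_re_lt [DecidableEq ι] {A : Matrix ι ι ℂ} (hA : A.IsHermitian)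
    (h : ∀ x : ι → ℂ, x ≠ 0 → (hermForm A x).re < ∑ i, ‖x i‖ ^ 2) : (1 - A).PosDef := by
  refine Matrix.PosDef.of_dotProduct_mulVec_pos (Matrix.isHermitian_one.sub hA) fun x hx => ?_
  change 0 < hermForm (1 - A) x
  have him : (hermForm A x).im = 0 := by
    have := hermForm_conjTranspose A x
    rw [hA.eq] at this
    exact Complex.conj_eq_iff_im.mp this.symm
  rw [hermForm_sub, hermForm_one, Complex.lt_def]
  constructor
  · rw [Complex.sub_re, Complex.ofReal_re]
    simpa using h x hx
  · rw [Complex.sub_im, Complex.ofReal_im, him]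
    simp

theorem integrable_exp_neg_of_norm_le {q : (ι → ℂ) → ℝ} (hq : Continuous q)
    {c : ℝ} (hc : c < 1) (h : ∀ x, q x ≤ c * ∑ i, ‖x i‖ ^ 2) :
    Integrable fun x : ι → ℂ => Real.exp (-∑ i, ‖x i‖ ^ 2 + q x) := by
  refine (integrable_exp_neg_sum_norm_sq ι (sub_pos.mpr hc)).mono'
    (by fun_prop) (Filter.Eventually.of_forall fun x => ?_)
  rw [Real.norm_of_nonneg (Real.exp_pos _).le, Real.exp_le_exp]
  have := h x
  linarith

/-- The Gaussian integral of a small complex perturbation of the standard Gaussian. -/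
theorem integral_cexp_hermForm_mul_det [DecidableEq ι] {K : Matrix ι ι ℂ}
    (hK : ∀ x, ‖hermForm K x‖ ≤ 1 / 2 * ∑ i, ‖x i‖ ^ 2) :
    (∫ x, Complex.exp (-((∑ i, ‖x i‖ ^ 2 : ℝ) : ℂ) + hermForm K x)) * (1 - K).det
      = Real.pi ^ Fintype.card ι := by
  -- Split `K = A + iB` with `A`, `B` Hermitian and replace `i` by a parameter `t`. For real `t` the
  -- matrix `A + tB` is Hermitian and the positive definite case applies. As a function of `t` the
  -- integral is the complex moment generating function of `X = Im x†Kx` under the density `w`, so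
  -- the identity continues to `t = i`.
  obtain ⟨A, hA⟩ : ∃ A : Matrix ι ι ℂ, A = (1 / 2 : ℂ) • (K + K.conjTranspose) := ⟨_, rfl⟩
  obtain ⟨B, hB⟩ : ∃ B : Matrix ι ι ℂ, B = (-Complex.I / 2 : ℂ) • (K - K.conjTranspose) := ⟨_, rfl⟩
  have hAh : A.IsHermitian := by
    rw [Matrix.IsHermitian, hA, Matrix.conjTranspose_smul, Matrix.conjTranspose_add,
      Matrix.conjTranspose_conjTranspose, add_comm]
    simp
  have hBh : B.IsHermitian := by
    rw [Matrix.IsHermitian, hB, Matrix.conjTranspose_smul, Matrix.conjTranspose_sub,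
      Matrix.conjTranspose_conjTranspose, ← neg_sub K, smul_neg, ← neg_smul]
    congr 1
    simp; ring
  have hKAB : K = A + Complex.I • B := by
    rw [hA, hB, smul_smul]
    have : Complex.I * (-Complex.I / 2) = 1 / 2 := by
      rw [mul_div_assoc', mul_neg, Complex.I_mul_I]; norm_num
    rw [this, ← smul_add]
    ext i j
    simp
    ring
  have hfA : ∀ x, hermForm A x = ((hermForm K x).re : ℂ) := by
    intro x
    rw [hA, hermForm_smul, hermForm_add, hermForm_conjTranspose]
    have := Complex.add_conj (hermForm K x)
    rw [RCLike.star_def, this]; push_cast; ring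
  have hfB : ∀ x, hermForm B x = ((hermForm K x).im : ℂ) := by
    intro x
    rw [hB, hermForm_smul, hermForm_sub, hermForm_conjTranspose]
    have := Complex.sub_conj (hermForm K x)
    rw [RCLike.star_def, this]
    push_cast
    linear_combination (-((hermForm K x).im : ℂ)) * Complex.I_mul_I
  have hre : ∀ x, |(hermForm K x).re| ≤ 1 / 2 * ∑ i, ‖x i‖ ^ 2 := fun x =>
    (Complex.abs_re_le_norm _).trans (hK x)
  have him : ∀ x, |(hermForm K x).im| ≤ 1 / 2 * ∑ i, ‖x i‖ ^ 2 := fun x =>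
    (Complex.abs_im_le_norm _).trans (hK x)
  have hct : Continuous (hermForm K) := continuous_hermForm K
  have hcre : Continuous fun x => (hermForm K x).re := Complex.continuous_re.comp hct
  have hcim : Continuous fun x => (hermForm K x).im := Complex.continuous_im.comp hct
  set w : (ι → ℂ) → ℝ := fun x => Real.exp (-∑ i, ‖x i‖ ^ 2 + (hermForm K x).re) with hw
  set μ : Measure (ι → ℂ) := volume.withDensity fun x => ENNReal.ofReal (w x) with hμ
  set X : (ι → ℂ) → ℝ := fun x => (hermForm K x).im with hX
  have hwm : Measurable w := by
    have : Continuous w := by fun_prop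
    exact this.measurable
  have hintμ : ∀ {F : Type} [NormedAddCommGroup F] [NormedSpace ℝ F] (g : (ι → ℂ) → F),
      ∫ x, g x ∂μ = ∫ x, w x • g x := by
    intro F _ _ g
    rw [hμ, integral_withDensity_eq_integral_toReal_smul hwm.ennreal_ofReal
      (Filter.Eventually.of_forall fun _ => ENNReal.ofReal_lt_top)]
    simp only [ENNReal.toReal_ofReal (Real.exp_pos _).le, hw]
  -- The constant `1 / 2` in the hypothesis leaves room for all `|t| < 1`, hence for the strip `|Re
  -- t| < 1`, which contains `i`.
  have hbound : ∀ t : ℝ, |t| < 1 → ∀ x, (hermForm K x).re + t * (hermForm K x).im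
      ≤ ((1 + |t|) / 2) * ∑ i, ‖x i‖ ^ 2 := by
    intro t ht x
    have h1 := (le_abs_self _).trans (hre x)
    have h2 : t * (hermForm K x).im ≤ |t| * (1 / 2 * ∑ i, ‖x i‖ ^ 2) :=
      (le_abs_self _).trans (by rw [abs_mul]; gcongr; exact him x)
    linarith
  have hset : Set.Ioo (-1 : ℝ) 1 ⊆ ProbabilityTheory.integrableExpSet X μ := by
    intro t ht
    have ht' : |t| < 1 := abs_lt.mpr ht
    change Integrable (fun x => Real.exp (t * X x)) μ
    rw [hμ, integrable_withDensity_iff_integrable_smul' hwm.ennreal_ofReal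
      (Filter.Eventually.of_forall fun _ => ENNReal.ofReal_lt_top)]
    refine (integrable_exp_neg_of_norm_le (q := fun x => (hermForm K x).re + t * (hermForm K x).im)
      (by fun_prop) (by linarith : (1 + |t|) / 2 < 1) (hbound t ht')).congr
      (Filter.Eventually.of_forall fun x => ?_)
    simp only [ENNReal.toReal_ofReal (Real.exp_pos _).le, hw, hX, smul_eq_mul]
    rw [← Real.exp_add]
    congr 1; ring
  set S : Set ℂ := Complex.re ⁻¹' Set.Ioo (-1 : ℝ) 1 with hS
  have hSconv : Convex ℝ S := (convex_Ioo (-1 : ℝ) 1).linear_preimage Complex.reLm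
  have han : AnalyticOnNhd ℂ (ProbabilityTheory.complexMGF X μ) S :=
    ProbabilityTheory.analyticOnNhd_complexMGF.mono fun z hz =>
      interior_mono hset (by rwa [interior_Ioo])
  have hdet : AnalyticOnNhd ℂ (fun t : ℂ => (1 - (A + t • B)).det) S := by
    have : Differentiable ℂ (fun t : ℂ => (1 - (A + t • B)).det) := by
      simp only [Matrix.det_apply]
      refine Differentiable.fun_sum fun σ _ => ?_
      refine Differentiable.const_smul ?_ _
      refine Differentiable.fun_finsetProd fun i _ => ?_
      simp only [Matrix.sub_apply, Matrix.add_apply, Matrix.smul_apply, smul_eq_mul]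
      fun_prop
    exact fun z _ => this.analyticAt z
  have hreal : ∀ t : ℝ, |t| < 1 → ProbabilityTheory.complexMGF X μ t * (1 - (A + (t : ℂ) • B)).det
      = Real.pi ^ Fintype.card ι := by
    intro t ht
    have hform : ∀ x, (hermForm (A + (t : ℂ) • B) x) =
        (((hermForm K x).re + t * (hermForm K x).im : ℝ) : ℂ) := by
      intro x
      rw [hermForm_add, hermForm_smul, hfA, hfB]; push_cast; rfl
    have hpd := posDef_one_sub_of_hermForm_re_lt (A := A + (t : ℂ) • B)
      (hAh.add (by
        rw [Matrix.IsHermitian, Matrix.conjTranspose_smul, hBh.eq]; simp)) (by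
        intro x hx
        rw [hform, Complex.ofReal_re]
        refine (hbound t ht x).trans_lt ?_
        have := sum_norm_sq_pos hx
        nlinarith)
    rw [← integral_exp_neg_hermForm_of_posDef hpd]
    congr 1
    rw [ProbabilityTheory.complexMGF, hintμ, ← integral_complex_ofReal]
    congr 1
    ext x
    rw [hermForm_sub, hermForm_one, hform, Complex.real_smul, hw, ← Complex.ofReal_sub,
      Complex.ofReal_re]
    push_cast
    rw [← Complex.exp_add]
    congr 1
    simp only [hX]
    ring
  have key : Set.EqOn (fun t : ℂ => ProbabilityTheory.complexMGF X μ t * (1 - (A + t • B)).det)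
      (fun _ => (Real.pi : ℂ) ^ Fintype.card ι) S := by
    refine AnalyticOnNhd.eqOn_of_preconnected_of_frequently_eq (z₀ := 0) (han.mul hdet)
      analyticOnNhd_const hSconv.isPreconnected (by simp [hS]) ?_
    -- The identity theorem needs real points accumulating at `0` and different from it; `1 / (n +
    -- 2)` also stays below `1`.
    have h1 : Filter.Tendsto (fun n : ℕ => ((1 / ((n : ℝ) + 2) : ℝ) : ℂ)) Filter.atTop
        (nhdsWithin 0 {0}ᶜ) := by
      refine tendsto_nhdsWithin_iff.mpr ⟨?_, Filter.Eventually.of_forall fun n => ?_⟩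
      · rw [← Complex.ofReal_zero]
        refine (Complex.continuous_ofReal.tendsto 0).comp ?_
        have := (tendsto_one_div_add_atTop_nhds_zero_nat (𝕜 := ℝ)).comp (Filter.tendsto_add_atTop_nat 1)
        refine this.congr fun n => ?_
        simp only [Function.comp]
        push_cast
        ring
      · simp only [Set.mem_compl_iff, Set.mem_singleton_iff, Complex.ofReal_eq_zero]
        positivity
    refine h1.frequently (Filter.Frequently.of_forall fun n => hreal _ ?_)
    rw [abs_of_nonneg (by positivity), div_lt_one (by positivity)]
    have : (0 : ℝ) ≤ n := n.cast_nonneg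
    linarith
  have hI := key (x := Complex.I) (by simp [hS])
  simp only [← hKAB] at hI
  rw [← hI]
  congr 1
  rw [ProbabilityTheory.complexMGF, hintμ]
  congr 1
  ext x
  rw [Complex.real_smul, hw]
  simp only [hX]
  rw [Complex.ofReal_exp, ← Complex.exp_add]
  congr 1
  conv_lhs => rw [← Complex.re_add_im (hermForm K x)]
  push_cast
  ring

end

/-! ### Haar integrals over `SU(2)` as Gaussian integrals over spinors. -/

namespace SpinNetwork

instance : SecondCountableTopology SU2 :=
  haveI : SecondCountableTopology (Matrix (Fin 2) (Fin 2) ℂ) :=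
    inferInstanceAs (SecondCountableTopology (Fin 2 → Fin 2 → ℂ))
  TopologicalSpace.Subtype.secondCountableTopology _

instance : haarSU2.IsHaarMeasure := by unfold haarSU2; infer_instance

instance : IsProbabilityMeasure haarSU2 :=
  ⟨by simpa [haarSU2] using Measure.haarMeasure_self (K₀ := (⊤ : TopologicalSpace.PositiveCompacts SU2))⟩

/-- A right translate of Haar measure is again a left Haar probability measure, and that measure is
unique. -/
instance : haarSU2.IsMulRightInvariant := ⟨fun g => by
  have : IsProbabilityMeasure (Measure.map (· * g) haarSU2) :=
    Measure.isProbabilityMeasure_map (measurable_mul_const g).aemeasurable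
  exact Measure.isHaarMeasure_eq_of_isProbabilityMeasure _ _⟩

/-- The matrix with first column the spinor `x` that is a multiple of an element of `SU(2)`. -/
def spinMat (x : Spinor) : Matrix (Fin 2) (Fin 2) ℂ :=
  !![x 0, -star (x 1); x 1, star (x 0)]

/-- The Euclidean length of a spinor. -/
def spinLen (x : Spinor) : ℝ := Real.sqrt (∑ i, ‖x i‖ ^ 2)

theorem spinLen_sq (x : Spinor) : spinLen x ^ 2 = ∑ i, ‖x i‖ ^ 2 :=
  Real.sq_sqrt (by positivity)

theorem spinLen_nonneg (x : Spinor) : 0 ≤ spinLen x := Real.sqrt_nonneg _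

theorem continuous_spinMat : Continuous spinMat := by
  refine continuous_matrix fun i j => ?_
  fin_cases i <;> fin_cases j <;> simp [spinMat] <;> fun_prop

theorem spinMat_smul (r : ℝ) (x : Spinor) : spinMat ((r : ℂ) • x) = (r : ℂ) • spinMat x := by
  ext i j
  fin_cases i <;> fin_cases j <;> simp [spinMat]

theorem SU2.mul_star_self (g : SU2) : (g : Matrix (Fin 2) (Fin 2) ℂ) * star g.1 = 1 :=
  Matrix.mem_unitaryGroup_iff.mp (Matrix.specialUnitaryGroup_le_unitaryGroup g.2)

theorem SU2.star_mul_self (g : SU2) : star g.1 * (g : Matrix (Fin 2) (Fin 2) ℂ) = 1 :=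
  Matrix.mem_unitaryGroup_iff'.mp (Matrix.specialUnitaryGroup_le_unitaryGroup g.2)

theorem SU2.det_eq_one (g : SU2) : (g : Matrix (Fin 2) (Fin 2) ℂ).det = 1 :=
  (Matrix.mem_specialUnitaryGroup_iff.mp g.2).2

/-- The inverse of `g` is both its adjugate and its conjugate transpose, so the second column is
determined by the first. Functions of `g` thereby become functions of the spinor `g e₀`. -/
theorem SU2.spinMat_col (g : SU2) : spinMat (g.1.mulVec (Pi.single 0 1)) = g.1 := by
  have h1 := SU2.star_mul_self g
  have hinv : g.1.adjugate = star g.1 := by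
    calc g.1.adjugate = star g.1 * (g.1 * g.1.adjugate) := by rw [← mul_assoc, h1, one_mul]
      _ = star g.1 := by rw [Matrix.mul_adjugate, SU2.det_eq_one, one_smul, mul_one]
  rw [Matrix.adjugate_fin_two] at hinv
  have e00 := congrFun (congrFun hinv 0) 0
  have e01 := congrFun (congrFun hinv 0) 1
  simp [Matrix.star_apply] at e00 e01
  ext i j
  fin_cases i <;> fin_cases j <;> simp [spinMat, ← e00, ← e01]

/-- Polar decomposition of a spinor: for `x ≠ 0` the rotation is `spinMat x` divided by the length;
for `x = 0` any rotation will do. -/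
theorem exists_SU2_smul (x : Spinor) :
    ∃ h : SU2, x = ((spinLen x : ℝ) : ℂ) • h.1.mulVec (Pi.single 0 1) := by
  by_cases h0 : spinLen x = 0
  · refine ⟨1, ?_⟩
    have h1 : ∑ i, ‖x i‖ ^ 2 = 0 := by rw [← spinLen_sq, h0]; simp
    rw [Finset.sum_eq_zero_iff_of_nonneg (fun _ _ => by positivity)] at h1
    ext i
    have := h1 i (Finset.mem_univ _)
    simp at this
    simp [h0, this]
  · have hr : ((spinLen x : ℝ) : ℂ) ≠ 0 := by exact_mod_cast h0
    have hsq : (spinLen x : ℂ) ^ 2 = x 0 * star (x 0) + x 1 * star (x 1) := by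
      simp only [RCLike.star_def, Complex.mul_conj']
      rw [← Complex.ofReal_pow, spinLen_sq, Fin.sum_univ_two]
      push_cast; rfl
    simp only [RCLike.star_def] at hsq
    have hmem : (((spinLen x : ℝ) : ℂ)⁻¹ • spinMat x) ∈ Matrix.specialUnitaryGroup (Fin 2) ℂ := by
      rw [Matrix.mem_specialUnitaryGroup_iff, Matrix.mem_unitaryGroup_iff]
      constructor
      · ext i j
        fin_cases i <;> fin_cases j <;>
          simp [spinMat, Matrix.mul_apply, Fin.sum_univ_two, Matrix.star_apply] <;>
          field_simp <;> rw [hsq] <;> ring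
      · rw [Matrix.det_smul, Matrix.det_fin_two]
        simp [spinMat]
        field_simp
        rw [hsq]; ring
    refine ⟨⟨_, hmem⟩, ?_⟩
    ext i
    fin_cases i <;> simp [spinMat, h0]

theorem SU2.sum_norm_sq_mulVec (g : SU2) (x : Spinor) :
    ∑ i, ‖g.1.mulVec x i‖ ^ 2 = ∑ i, ‖x i‖ ^ 2 := by
  have : hermForm 1 (g.1.mulVec x) = hermForm 1 x := by
    simp only [hermForm, Matrix.one_mulVec, Matrix.star_mulVec, ← Matrix.dotProduct_mulVec,
      Matrix.mulVec_mulVec]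
    rw [← Matrix.star_eq_conjTranspose, one_mul, SU2.star_mul_self, Matrix.one_mulVec]
  rw [hermForm_one, hermForm_one] at this
  exact_mod_cast this

/-- Polar coordinates in `ℝ⁴` reduce this to a Gamma integral times a ball volume. The volume is not
computed: the case `N = 0`, whose value `π²` is known, fixes it. With `N = 2 J_v` this is the source
of `(J_v + 1)!`. -/
theorem integral_spinLen_pow (N : ℕ) :
    ∫ x : Spinor, spinLen x ^ N * Real.exp (-∑ i, ‖x i‖ ^ 2)
      = Real.pi ^ 2 * Real.Gamma (N / 2 + 2) := by
  let e : Spinor ≃L[ℝ] EuclideanSpace ℂ (Fin 2) :=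
    (PiLp.continuousLinearEquiv 2 ℝ (fun _ : Fin 2 => ℂ)).symm
  let μ : Measure (EuclideanSpace ℂ (Fin 2)) := Measure.map e volume
  have hμ : μ.IsAddHaarMeasure := e.isAddHaarMeasure_map _
  have hnorm : ∀ x : Spinor, ‖e x‖ = spinLen x := fun x => by
    rw [EuclideanSpace.norm_eq]; rfl
  have hfin : Module.finrank ℝ (EuclideanSpace ℂ (Fin 2)) = 4 := by
    rw [finrank_real_of_complex, finrank_euclideanSpace]; simp
  have key : ∀ M : ℕ, ∫ x : Spinor, spinLen x ^ M * Real.exp (-∑ i, ‖x i‖ ^ 2)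
      = 4 * μ.real (Metric.ball 0 1) * (1 / 2 * Real.Gamma (M / 2 + 2)) := by
    intro M
    have h1 := integral_fun_norm_addHaar μ (fun r => r ^ M * Real.exp (-r ^ 2))
    have h2 : ∫ x, ‖x‖ ^ M * Real.exp (-‖x‖ ^ 2) ∂μ
        = ∫ x : Spinor, spinLen x ^ M * Real.exp (-∑ i, ‖x i‖ ^ 2) := by
      have he : MeasurableEmbedding e := e.toHomeomorph.measurableEmbedding
      rw [he.integral_map]
      simp only [← spinLen_sq, ← hnorm]
    rw [← h2, h1, hfin]
    have h3 := integral_rpow_mul_exp_neg_rpow (p := 2) (q := M + 3) two_pos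
      (by have : (0 : ℝ) ≤ M := M.cast_nonneg
          linarith)
    have h4 : ∫ y in Set.Ioi (0 : ℝ), y ^ (4 - 1) • (y ^ M * Real.exp (-y ^ 2))
        = 1 / 2 * Real.Gamma (M / 2 + 2) := by
      rw [show (M : ℝ) / 2 + 2 = (M + 3 + 1) / 2 by ring, ← h3]
      refine setIntegral_congr_fun measurableSet_Ioi fun y hy => ?_
      rw [smul_eq_mul, ← mul_assoc, ← pow_add, Real.rpow_two,
        show ((M : ℝ) + 3) = ((3 + M : ℕ) : ℝ) by push_cast; ring, Real.rpow_natCast]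
    rw [h4]
    simp [mul_assoc]
  have h0 := key 0
  have hg := integral_exp_neg_sum_norm_sq (Fin 2)
  simp only [pow_zero, one_mul] at h0
  rw [hg] at h0
  simp at h0
  rw [key, h0]
  ring

theorem integrable_spinLen_pow (N : ℕ) :
    Integrable fun x : Spinor => spinLen x ^ N * Real.exp (-∑ i, ‖x i‖ ^ 2) := by
  -- A non-integrable function has integral `0` by convention, whereas the value just found is
  -- positive.
  by_contra h
  have h1 := integral_undef h
  rw [integral_spinLen_pow] at h1
  have : 0 < Real.Gamma (N / 2 + 2) := Real.Gamma_pos_of_pos (by positivity)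
  have := Real.pi_pos
  exact absurd h1 (by positivity)

variable {V : Type*} [Fintype V]

/-- Integrals of homogeneous functions over `SU(2)^V` are Gaussian integrals. -/
theorem integral_homogeneous_mul_exp {f : (V → Spinor) → ℂ} (hf : Continuous f) {N : V → ℕ}
    (hN : ∀ (r : V → ℝ) x, f (fun v => (r v : ℂ) • x v) = (∏ v, (r v : ℂ) ^ N v) * f x) :
    ∫ x : V → Spinor, f x * Real.exp (-∑ v, ∑ i, ‖x v i‖ ^ 2) =
      (∏ v, ((Real.pi ^ 2 * Real.Gamma (N v / 2 + 2) : ℝ) : ℂ)) *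
        ∫ g : V → SU2, f (fun v => (g v).1.mulVec (Pi.single 0 1))
          ∂(Measure.pi fun _ : V => haarSU2) := by
  set ν : Measure (V → SU2) := Measure.pi fun _ : V => haarSU2 with hν
  set w : (V → Spinor) → ℝ := fun x => Real.exp (-∑ v, ∑ i, ‖x v i‖ ^ 2) with hw
  set T : (V → SU2) → (V → Spinor) → (V → Spinor) := fun g x v => (g v).1.mulVec (x v) with hT
  have hTc : Continuous (Function.uncurry T) := by
    refine continuous_pi fun v => ?_
    exact Continuous.matrix_mulVec (by fun_prop) (by fun_prop)
  set e0 : V → Spinor := fun _ => Pi.single 0 1 with he0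
  have hwc : Continuous w := by fun_prop
  have hTw : ∀ g x, w (T g x) = w x := fun g x => by
    simp only [hw, hT, SU2.sum_norm_sq_mulVec]
  have hTpres : ∀ g, MeasurePreserving (T g) := fun g =>
    volume_preserving_pi fun v => Complex.measurePreserving_mulVec _ (by
      rw [SU2.det_eq_one]; simp)
  have hTme : ∀ g, MeasurableEmbedding (T g) := fun g => by
    have hinj : ∀ x, T g⁻¹ (T g x) = x := fun x => by
      ext v i
      simp only [hT, Matrix.mulVec_mulVec, Pi.inv_apply]
      have : ((g v)⁻¹).1 * (g v).1 = 1 := SU2.star_mul_self (g v)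
      rw [this, Matrix.one_mulVec]
    have hinj' : ∀ x, T g (T g⁻¹ x) = x := fun x => by
      ext v i
      simp only [hT, Matrix.mulVec_mulVec, Pi.inv_apply]
      have : (g v).1 * ((g v)⁻¹).1 = 1 := SU2.mul_star_self (g v)
      rw [this, Matrix.one_mulVec]
    let H : (V → Spinor) ≃ₜ (V → Spinor) :=
      { toFun := T g
        invFun := T g⁻¹
        left_inv := hinj
        right_inv := hinj'
        continuous_toFun := hTc.comp (by fun_prop : Continuous fun x => (g, x))
        continuous_invFun := hTc.comp (by fun_prop : Continuous fun x => (g⁻¹, x)) }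
    exact H.measurableEmbedding
  -- Homogeneity pulls out the lengths; the directions of the `x v` survive only as a right
  -- translation of `g` by `h`.
  have hpolar : ∀ x, ∃ h : V → SU2, ∀ g, f (T g x) = (∏ v, (spinLen (x v) : ℂ) ^ N v) * f (T (g * h) e0) := by
    intro x
    choose h hh using fun v => exists_SU2_smul (x v)
    refine ⟨h, fun g => ?_⟩
    rw [← hN]
    congr 1
    ext v i
    simp only [hT, he0]
    conv_lhs => rw [hh v]
    rw [Matrix.mulVec_smul, Matrix.mulVec_mulVec]
    rfl
  have hprod : ∀ x, (∏ v, (spinLen (x v) ^ N v * Real.exp (-∑ i, ‖x v i‖ ^ 2)))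
      = (∏ v, spinLen (x v) ^ N v) * w x := fun x => by
    rw [Finset.prod_mul_distrib, ← Real.exp_sum, Finset.sum_neg_distrib]
  have hint : Integrable (fun x : V → Spinor => (∏ v, spinLen (x v) ^ N v) * w x) := by
    refine (Integrable.fintype_prod (ι := V) fun v => integrable_spinLen_pow (N v)).congr
      (Filter.Eventually.of_forall hprod)
  obtain ⟨M, hM⟩ : ∃ M : ℝ, ∀ g, ‖f (T g e0)‖ ≤ M := by
    have hc : Continuous fun g => f (T g e0) :=
      hf.comp (hTc.comp (by fun_prop : Continuous fun g => (g, e0)))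
    obtain ⟨M, hM⟩ := (isCompact_range hc).isBounded.exists_norm_le
    exact ⟨M, fun g => hM _ ⟨g, rfl⟩⟩
  have hjoint : Integrable (Function.uncurry fun (g : V → SU2) (x : V → Spinor) => f (T g x) * (w x : ℂ))
      (ν.prod volume) := by
    refine ((hint.comp_snd ν).const_mul M).mono' ?_ (Filter.Eventually.of_forall ?_)
    · refine Continuous.aestronglyMeasurable ?_
      refine (hf.comp hTc).mul ?_
      exact Complex.continuous_ofReal.comp (hwc.comp continuous_snd)
    · rintro ⟨g, x⟩
      obtain ⟨h, hh⟩ := hpolar x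
      simp only [Function.uncurry]
      rw [hh, norm_mul, norm_mul, norm_prod, Complex.norm_real, Real.norm_of_nonneg (Real.exp_pos _).le]
      simp only [norm_pow, Complex.norm_real, Real.norm_of_nonneg (spinLen_nonneg _)]
      rw [mul_comm (∏ v, _), mul_assoc]
      gcongr
      · exact mul_nonneg (Finset.prod_nonneg fun v _ => pow_nonneg (spinLen_nonneg _) _)
          (Real.exp_pos _).le
      · exact hM _
  -- Rotations preserve both Lebesgue measure and the Gaussian weight, so averaging over `g` changes
  -- nothing.
  have step1 : (∫ x, f x * (w x : ℂ)) = ∫ g, (∫ x, f (T g x) * (w x : ℂ)) ∂ν := by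
    have : ∀ g, (∫ x, f (T g x) * (w x : ℂ)) = ∫ x, f x * (w x : ℂ) := fun g => by
      rw [← (hTpres g).integral_comp (hTme g) (fun x => f x * (w x : ℂ))]
      simp only [hTw]
    simp only [this]
    simp
  -- Right invariance of Haar measure absorbs `h`, leaving only the lengths of the `x v`.
  have step2 : ∀ x, ∫ g, f (T g x) * (w x : ℂ) ∂ν
      = (((∏ v, spinLen (x v) ^ N v) * w x : ℝ) : ℂ) * ∫ g, f (T g e0) ∂ν := by
    intro x
    obtain ⟨h, hh⟩ := hpolar x
    simp only [hh]
    rw [integral_mul_const, integral_const_mul,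
      integral_mul_right_eq_self (fun g => f (T g e0)) h]
    push_cast
    ring
  refine Eq.trans (b := ∫ x, f x * (w x : ℂ)) rfl ?_
  rw [step1, integral_integral_swap hjoint]
  simp only [step2]
  rw [integral_mul_const, integral_complex_ofReal]
  congr 1
  simp only [← hprod]
  rw [integral_fintype_prod_volume_eq_prod fun (v : V) (x : Spinor) =>
    spinLen x ^ N v * Real.exp (-∑ i, ‖x i‖ ^ 2)]
  simp only [integral_spinLen_pow]
  push_cast
  rfl

end SpinNetwork

/-! ### Products of exponential series as sums over multi-indices. -/

theorem hasSum_prod_pi_fin (m : ℕ) : ∀ f : Fin m → ℕ → ℂ, (∀ e, Summable fun k => ‖f e k‖) →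
    (Summable fun n : Fin m → ℕ => ‖∏ e, f e (n e)‖) ∧
      HasSum (fun n : Fin m → ℕ => ∏ e, f e (n e)) (∏ e, ∑' k, f e k) := by
  induction m with
  | zero =>
    intro f _
    refine ⟨Summable.of_finite, ?_⟩
    simp
  | succ m ih =>
    intro f hf
    obtain ⟨h1, h2⟩ := ih (fun a => f a.succ) fun a => hf a.succ
    let φ : ℕ × (Fin m → ℕ) ≃ (Fin (m + 1) → ℕ) := Fin.consEquiv fun _ => ℕ
    have hp : ∀ n : ℕ × (Fin m → ℕ), ∏ b, f b (φ n b) = f 0 n.1 * ∏ a : Fin m, f a.succ (n.2 a) := by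
      intro n
      rw [Fin.prod_univ_succ]
      rfl
    have h3 := hf 0
    have hs : Summable fun n : ℕ × (Fin m → ℕ) => ‖f 0 n.1 * ∏ a : Fin m, f a.succ (n.2 a)‖ :=
by
      have := h3.mul_norm h1
      exact this
    constructor
    · rw [← φ.summable_iff]
      simpa only [Function.comp_def, hp] using hs
    · rw [← φ.hasSum_iff, Fin.prod_univ_succ]
      simp only [Function.comp_def, hp]
      have h4 : HasSum (fun k => f 0 k) (∑' k, f 0 k) := h3.of_norm.hasSum
      have h5 : Summable fun n : ℕ × (Fin m → ℕ) => f 0 n.1 * ∏ a : Fin m, f a.succ (n.2 a) :=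
        hs.of_norm
      have h6 := h4.mul h2 h5
      exact h6

theorem hasSum_prod_pi {E : Type*} [Fintype E] (f : E → ℕ → ℂ)
    (hf : ∀ e, Summable fun k => ‖f e k‖) :
    (Summable fun n : E → ℕ => ‖∏ e, f e (n e)‖) ∧
      HasSum (fun n : E → ℕ => ∏ e, f e (n e)) (∏ e, ∑' k, f e k) := by
  let ψ := (Fintype.equivFin E).symm
  let φ := ψ.arrowCongr (Equiv.refl ℕ)
  obtain ⟨h1, h2⟩ := hasSum_prod_pi_fin _ (fun a => f (ψ a)) fun a => hf (ψ a)
  have hp : ∀ n, ∏ b, f b (φ n b) = ∏ a, f (ψ a) (n a) := by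
    intro n
    rw [← ψ.prod_comp]
    simp [φ]
  constructor
  · rw [← φ.summable_iff]
    simpa only [Function.comp_def, hp] using h1
  · rw [← φ.hasSum_iff, ← ψ.prod_comp]
    simpa only [Function.comp_def, hp] using h2

theorem hasSum_prod_pow_div_factorial {E : Type*} [Fintype E] (q : E → ℂ) :
    HasSum (fun n : E → ℕ => ∏ e, q e ^ n e / ((n e).factorial : ℂ)) (Complex.exp (∑ e, q e)) := by
  have h := (hasSum_prod_pi (fun e k => q e ^ k / (k.factorial : ℂ)) fun e => by
    simpa using Real.summable_pow_div_factorial ‖q e‖).2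
  have h2 : ∀ e, ∑' k : ℕ, q e ^ k / (k.factorial : ℂ) = Complex.exp (q e) := fun e => by
    rw [Complex.exp_eq_exp_ℂ, NormedSpace.exp_eq_tsum_div]
  simp only [h2] at h
  rwa [Complex.exp_sum]

/-- This provides the dominating function for exchanging the sum over spins with the Gaussian
integral. -/
theorem hasSum_norm_prod_pow_div_factorial {E : Type*} [Fintype E] (q : E → ℂ) :
    HasSum (fun n : E → ℕ => ‖∏ e, q e ^ n e / ((n e).factorial : ℂ)‖)
      (Real.exp (∑ e, ‖q e‖)) := by
  have h := hasSum_prod_pow_div_factorial fun e => ((‖q e‖ : ℝ) : ℂ)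
  rw [← Complex.hasSum_ofReal]
  convert h using 1
  · ext n
    rw [norm_prod]
    simp
  · push_cast; rfl

/-! ### Terms of the generating functional as Gaussian integrals. -/

namespace SpinNetwork.OrientedGraph

variable {V E : Type*} (Γ : OrientedGraph V E)

/-- The contribution of an edge to the exponent of the Gaussian integral. -/
def edgeForm (z : SpinorData E) (e : E) (x : V → Spinor) : ℂ :=
  bracket (z (e, true))
    ((spinMat (x (Γ.src e)) * star (spinMat (x (Γ.tgt e)))).mulVec (z (e, false)))

theorem continuous_edgeForm (z : SpinorData E) (e : E) : Continuous (Γ.edgeForm z e) := by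
  have h : Continuous fun x : V → Spinor =>
      (spinMat (x (Γ.src e)) * star (spinMat (x (Γ.tgt e)))).mulVec (z (e, false)) := by
    have h1 : ∀ v, Continuous fun x : V → Spinor => spinMat (x v) := fun v =>
      continuous_spinMat.comp (continuous_apply v)
    exact ((h1 _).matrix_mul (h1 _).star).matrix_mulVec continuous_const
  unfold edgeForm bracket
  fun_prop

/-- Each end of an edge contributes one factor; a loop contributes two at the same vertex, in
agreement with `degreeSum`. -/
theorem edgeForm_smul (z : SpinorData E) (e : E) (r : V → ℝ) (x : V → Spinor) :
    Γ.edgeForm z e (fun v => (r v : ℂ) • x v) =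
      (r (Γ.src e) : ℂ) * r (Γ.tgt e) * Γ.edgeForm z e x := by
  simp only [edgeForm, spinMat_smul, star_smul, Matrix.smul_mul, Matrix.mul_smul, Matrix.smul_mulVec,
    bracket, Pi.smul_apply, smul_eq_mul, RCLike.star_def, Complex.conj_ofReal]
  ring

/-- The number of half-edges at a vertex, weighted by the occupation numbers. -/
def degreeSum [Fintype E] [DecidableEq V] (n : E → ℕ) (v : V) : ℕ :=
  (∑ e with Γ.src e = v, n e) + ∑ e with Γ.tgt e = v, n e

theorem spinSum_eq [Fintype E] [DecidableEq V] (n : E → ℕ) (v : V) :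
    Γ.spinSum n v = (Γ.degreeSum n v : ℝ) / 2 := by
  simp only [spinSum, degreeSum, ← Finset.sum_div]
  push_cast
  rw [add_div]
  congr!

/-- The product over edges is homogeneous of degree `2 J_v` in `x_v`, so its radial integrals give
exactly `π² Γ(J_v + 2)` per vertex. At `x_v = g_v e₀` it is the integrand of the amplitude. -/
theorem genTerm_eq_integral [Fintype V] [Fintype E] (z : SpinorData E) (n : E → ℕ) :
    Γ.genTerm z n * (Real.pi : ℂ) ^ (2 * Fintype.card V) =
      ∫ x : V → Spinor, (∏ e, Γ.edgeForm z e x ^ n e / ((n e).factorial : ℂ)) *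
        Real.exp (-∑ v, ∑ i, ‖x v i‖ ^ 2) := by
  classical
  rw [integral_homogeneous_mul_exp (N := Γ.degreeSum n)
    (f := fun x => ∏ e, Γ.edgeForm z e x ^ n e / ((n e).factorial : ℂ))]
  · have hamp : Γ.amplitude n z = ∫ g : V → SU2, ∏ e, Γ.edgeForm z e
        (fun v => (g v).1.mulVec (Pi.single 0 1)) ^ n e / ((n e).factorial : ℂ)
        ∂(Measure.pi fun _ : V => haarSU2) := by
      unfold amplitude edgeForm
      simp only [SU2.spinMat_col]
      rfl
    rw [genTerm, hamp, mul_right_comm]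
    congr 1
    simp only [spinSum_eq]
    push_cast
    rw [Finset.prod_mul_distrib, Finset.prod_const, Finset.card_univ, ← pow_mul, mul_comm]
  · exact continuous_finsetProd _ fun e _ => ((Γ.continuous_edgeForm z e).pow _).div_const _
  · intro r x
    simp only [edgeForm_smul, mul_pow, mul_div_assoc, Finset.prod_mul_distrib]
    congr 1
    simp only [degreeSum, pow_add, Finset.prod_mul_distrib, ← Finset.prod_pow_eq_pow_sum]
    rw [← Finset.prod_fiberwise (s := Finset.univ) (g := Γ.src) (f := fun e => (r (Γ.src e) : ℂ) ^ n e),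
      ← Finset.prod_fiberwise (s := Finset.univ) (g := Γ.tgt) (f := fun e => (r (Γ.tgt e) : ℂ) ^ n e)]
    congr 1 <;>
    · refine Finset.prod_congr rfl fun v _ => Finset.prod_congr rfl fun e he => ?_
      rw [(Finset.mem_filter.mp he).2]

end SpinNetwork.OrientedGraph

/-! ### The matrix of the exponent and the summation of the series. -/

theorem integral_comp_uncurry {V F : Type*} [Fintype V] [NormedAddCommGroup F] [NormedSpace ℝ F]
    (f : (V × Fin 2 → ℂ) → F) :
    ∫ x : V → Fin 2 → ℂ, f (fun a => x a.1 a.2) = ∫ y, f y := by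
  let e := MeasurableEquiv.curry V (Fin 2) ℂ
  have h : MeasurePreserving e.symm := by
    refine ⟨e.symm.measurable, ?_⟩
    refine (Measure.pi_eq fun s hs => ?_).symm
    rw [e.symm.map_apply]
    have : e.symm ⁻¹' Set.univ.pi s = Set.univ.pi fun v => Set.univ.pi fun i => s (v, i) := by
      ext x
      simp only [Set.mem_preimage, Set.mem_univ_pi, Prod.forall]
      rfl
    rw [this, volume_pi_pi]
    simp only [volume_pi_pi]
    rw [Fintype.prod_prod_type]
  exact h.integral_comp e.symm.measurableEmbedding f

theorem norm_hermForm_le {ι : Type*} [Fintype ι] {K : Matrix ι ι ℂ} {κ : ℝ}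
    (hK : ∀ a b, ‖K a b‖ ≤ κ) (x : ι → ℂ) :
    ‖hermForm K x‖ ≤ κ * Fintype.card ι * ∑ i, ‖x i‖ ^ 2 := by
  have h1 : ‖hermForm K x‖ ≤ ∑ a, ∑ b, ‖x a‖ * (κ * ‖x b‖) := by
    unfold hermForm dotProduct Matrix.mulVec dotProduct
    refine (norm_sum_le _ _).trans (Finset.sum_le_sum fun a _ => ?_)
    rw [norm_mul, ← Finset.mul_sum]
    simp only [Pi.star_apply, norm_star]
    gcongr
    refine (norm_sum_le _ _).trans (Finset.sum_le_sum fun b _ => ?_)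
    rw [norm_mul]
    gcongr
    exact hK a b
  refine h1.trans ?_
  by_cases hι : Nonempty ι
  · have hκ : 0 ≤ κ := (norm_nonneg _).trans (hK hι.some hι.some)
    have h2 : ∑ a, ∑ b, ‖x a‖ * (κ * ‖x b‖) = κ * (∑ a, ‖x a‖) ^ 2 := by
      simp only [← Finset.mul_sum, ← Finset.sum_mul]
      ring
    rw [h2, mul_assoc]
    gcongr
    have := sq_sum_le_card_mul_sum_sq (s := Finset.univ) (f := fun a => ‖x a‖)
    simpa using this
  · rw [not_nonempty_iff] at hι
    simp

namespace SpinNetwork.OrientedGraph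

open Classical in
/-- The contribution of a directed edge to the matrix of the exponent. -/
def dirKernel {V E : Type*} (Γ : OrientedGraph V E) (z : SpinorData E) (d : DirEdge E) :
    Matrix (V × Fin 2) (V × Fin 2) ℂ := fun a b =>
  if Γ.start d = a.1 ∧ Γ.finish d = b.1 then
    (if d.2 then 1 else -1) * z d a.2 * ![z d.rev 1, -z d.rev 0] b.2
  else 0

variable {V E : Type*} (Γ : OrientedGraph V E)

/-- The sum of the contributions of a set of directed edges. -/
def kernelOn (z : SpinorData E) (S : Finset (DirEdge E)) : Matrix (V × Fin 2) (V × Fin 2) ℂ :=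
  ∑ d ∈ S, Γ.dirKernel z d

theorem hermForm_dirKernel [Fintype V] (z : SpinorData E) (d : DirEdge E) (x : V → Spinor) :
    hermForm (Γ.dirKernel z d) (fun a => x a.1 a.2) =
      (if d.2 then 1 else -1) * (∑ i, star (x (Γ.start d) i) * z d i) *
        (∑ j, ![z d.rev 1, -z d.rev 0] j * x (Γ.finish d) j) := by
  classical
  unfold hermForm dotProduct Matrix.mulVec dotProduct dirKernel
  rw [Fintype.sum_prod_type, Finset.sum_eq_single (Γ.start d)]
  · simp only [Fintype.sum_prod_type]
    rw [mul_assoc, Finset.sum_mul, Finset.mul_sum]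
    refine Finset.sum_congr rfl fun i _ => ?_
    rw [Finset.sum_eq_single (Γ.finish d)]
    · simp only [Finset.mul_sum, and_self, if_true, Pi.star_apply]
      exact Finset.sum_congr rfl fun j _ => by ring
    · intro v _ hv
      simp [Ne.symm hv]
    · simp
  · intro v _ hv
    simp [Ne.symm hv]
  · simp

/-- The columns of `spinMat x` are `x` and its dual spinor. In `spinMat x * star (spinMat y)` the
second columns give the term of the edge and the first columns that of the reversed edge, with its
minus sign. -/
theorem edgeForm_eq [Fintype V] (z : SpinorData E) (e : E) (x : V → Spinor) :
    Γ.edgeForm z e x = hermForm (Γ.dirKernel z (e, true)) (fun a => x a.1 a.2) +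
      hermForm (Γ.dirKernel z (e, false)) (fun a => x a.1 a.2) := by
  rw [hermForm_dirKernel, hermForm_dirKernel]
  simp [edgeForm, bracket, spinMat, Matrix.mulVec, dotProduct, Fin.sum_univ_two,
    Matrix.mul_apply, Matrix.star_apply, start, finish, DirEdge.rev]
  ring

theorem norm_dirKernel_le {z : SpinorData E} {ε : ℝ} (hz : ∀ d, ‖z d‖ ≤ ε) (d : DirEdge E)
    (a b : V × Fin 2) : ‖Γ.dirKernel z d a b‖ ≤ ε ^ 2 := by
  have hε : 0 ≤ ε := (norm_nonneg _).trans (hz d)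
  have hb : ∀ d i, ‖z d i‖ ≤ ε := fun d i => (norm_le_pi_norm _ i).trans (hz d)
  have h2 : ∀ j, ‖![z d.rev 1, -z d.rev 0] j‖ ≤ ε := by
    intro j
    fin_cases j
    · simpa using hb _ _
    · simpa using hb _ _
  unfold dirKernel
  split_ifs
  · rw [norm_mul, norm_mul, norm_one, one_mul, sq]
    exact mul_le_mul (hb _ _) (h2 _) (norm_nonneg _) hε
  · rw [norm_mul, norm_mul, norm_neg, norm_one, one_mul, sq]
    exact mul_le_mul (hb _ _) (h2 _) (norm_nonneg _) hε
  · simpa using sq_nonneg ε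

theorem hermForm_sum {ι κ : Type*} [Fintype ι] (s : Finset κ) (K : κ → Matrix ι ι ℂ) (x : ι → ℂ) :
    hermForm (∑ k ∈ s, K k) x = ∑ k ∈ s, hermForm (K k) x := by
  simp only [hermForm, Matrix.sum_mulVec, dotProduct_sum]

variable [Fintype V] [Fintype E]

theorem sum_edgeForm (z : SpinorData E) (x : V → Spinor) :
    ∑ e, Γ.edgeForm z e x = hermForm (Γ.kernelOn z Finset.univ) (fun a => x a.1 a.2) := by
  rw [kernelOn, hermForm_sum, Fintype.sum_prod_type]
  simp only [edgeForm_eq, Fintype.sum_bool]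

/-- Spinor data are small if the exponents of all Gaussian integrals are dominated. -/
def IsSmall (z : SpinorData E) : Prop :=
  ∀ x : V × Fin 2 → ℂ, ∑ d, ‖hermForm (Γ.dirKernel z d) x‖ ≤ 1 / 2 * ∑ i, ‖x i‖ ^ 2

theorem exists_isSmall : ∃ ε : ℝ, 0 < ε ∧ ∀ z : SpinorData E, (∀ d, ‖z d‖ < ε) → Γ.IsSmall z := by
  set c : ℝ := Fintype.card (DirEdge E) * Fintype.card (V × Fin 2) with hc
  have hc0 : 0 ≤ c := by positivity
  -- Each directed edge contributes at most `ε ^ 2 * card (V × Fin 2)`, so `ε ^ 2 * c ≤ 1 / 2`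
  -- suffices; the `+ 1` keeps the radius positive when `c = 0`.
  refine ⟨1 / (2 * (c + 1)), by positivity, fun z hz x => ?_⟩
  set ε : ℝ := 1 / (2 * (c + 1)) with hε
  have h1 : ∀ d, ‖hermForm (Γ.dirKernel z d) x‖
      ≤ ε ^ 2 * Fintype.card (V × Fin 2) * ∑ i, ‖x i‖ ^ 2 := fun d =>
    norm_hermForm_le (Γ.norm_dirKernel_le (fun d => (hz d).le) d) x
  refine (Finset.sum_le_sum fun d _ => h1 d).trans ?_
  rw [Finset.sum_const, nsmul_eq_mul, Finset.card_univ, ← mul_assoc]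
  gcongr
  have h2 : (Fintype.card (DirEdge E) : ℝ) * (ε ^ 2 * Fintype.card (V × Fin 2)) = ε ^ 2 * c := by
    rw [hc]; ring
  rw [h2, hε, div_pow, one_pow, div_mul_eq_mul_div, div_le_iff₀ (by positivity)]
  nlinarith

variable {Γ}

/-- `IsSmall` bounds a sum of norms, so a single condition serves every subset of directed edges and
thus every stage of the elimination. -/
theorem IsSmall.norm_hermForm_kernelOn {z : SpinorData E} (hz : Γ.IsSmall z)
    (S : Finset (DirEdge E)) (x : V × Fin 2 → ℂ) :
    ‖hermForm (Γ.kernelOn z S) x‖ ≤ 1 / 2 * ∑ i, ‖x i‖ ^ 2 := by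
  rw [kernelOn, hermForm_sum]
  refine (norm_sum_le _ _).trans ((Finset.sum_le_sum_of_subset_of_nonneg (Finset.subset_univ _)
    fun _ _ _ => norm_nonneg _).trans (hz x))

-- Dominated convergence: the norms of the terms add up to `exp(∑ ‖Q_e‖)` times the Gaussian weight,
-- which is integrable because `∑ ‖Q_e‖ ≤ |x|² / 2`.
open Classical in
theorem IsSmall.hasSum_genTerm {z : SpinorData E} (hz : Γ.IsSmall z) :
    HasSum (Γ.genTerm z) (1 / (1 - Γ.kernelOn z Finset.univ).det) := by
  set w : (V → Spinor) → ℝ := fun x => Real.exp (-∑ v, ∑ i, ‖x v i‖ ^ 2) with hw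
  have hwc : Continuous w := by fun_prop
  have hcts : ∀ n : E → ℕ, Continuous fun x : V → Spinor =>
      (∏ e, Γ.edgeForm z e x ^ n e / ((n e).factorial : ℂ)) := fun n =>
    continuous_finsetProd _ fun e _ => ((Γ.continuous_edgeForm z e).pow _).div_const _
  have hsum : HasSum (fun n : E → ℕ => ∫ x : V → Spinor,
      (∏ e, Γ.edgeForm z e x ^ n e / ((n e).factorial : ℂ)) * (w x : ℂ))
      (∫ x : V → Spinor, Complex.exp (∑ e, Γ.edgeForm z e x) * (w x : ℂ)) := by
    have hbs : ∀ x, HasSum (fun n : E → ℕ =>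
        ‖∏ e, Γ.edgeForm z e x ^ n e / ((n e).factorial : ℂ)‖ * w x)
        (Real.exp (∑ e, ‖Γ.edgeForm z e x‖) * w x) := fun x =>
      (hasSum_norm_prod_pow_div_factorial fun e => Γ.edgeForm z e x).mul_right _
    refine hasSum_integral_of_dominated_convergence
      (fun n x => ‖∏ e, Γ.edgeForm z e x ^ n e / ((n e).factorial : ℂ)‖ * w x)
      (fun n => ?_) (fun n => Filter.Eventually.of_forall fun x => ?_)
      (Filter.Eventually.of_forall fun x => (hbs x).summable) ?_
      (Filter.Eventually.of_forall fun x => ?_)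
    · exact ((hcts n).mul (Complex.continuous_ofReal.comp hwc)).aestronglyMeasurable
    · rw [norm_mul, Complex.norm_real, Real.norm_of_nonneg (Real.exp_pos _).le]
    · simp only [(hbs _).tsum_eq]
      have hq : Continuous fun y : V × Fin 2 → ℂ => ∑ e, ‖Γ.edgeForm z e (fun v i => y (v, i))‖ := by
        refine continuous_finsetSum _ fun e _ => ((Γ.continuous_edgeForm z e).comp ?_).norm
        fun_prop
      have hle : ∀ y : V × Fin 2 → ℂ, ∑ e, ‖Γ.edgeForm z e (fun v i => y (v, i))‖
          ≤ 1 / 2 * ∑ a, ‖y a‖ ^ 2 := fun y => by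
        refine le_trans ?_ (hz y)
        rw [Fintype.sum_prod_type]
        refine Finset.sum_le_sum fun e _ => ?_
        rw [edgeForm_eq, Fintype.sum_bool]
        exact norm_add_le _ _
      have hi := integrable_exp_neg_of_norm_le hq (by norm_num : (1 / 2 : ℝ) < 1) hle
      -- Integrability passes from `V × Fin 2 → ℂ` to the curried space through values: the integral
      -- is positive on one side, while a non-integrable function would give `0` on the other.
      by_contra hni
      have h1 := integral_comp_uncurry fun y : V × Fin 2 → ℂ => Real.exp (-∑ i, ‖y i‖ ^ 2 +
        ∑ e, ‖Γ.edgeForm z e (fun v i => y (v, i))‖)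
      have h2 : 0 < ∫ y : V × Fin 2 → ℂ, Real.exp (-∑ i, ‖y i‖ ^ 2 +
          ∑ e, ‖Γ.edgeForm z e (fun v i => y (v, i))‖) :=
        integral_exp_pos hi
      rw [← h1, integral_undef] at h2
      · exact lt_irrefl _ h2
      · refine fun h3 => hni (h3.congr (Filter.Eventually.of_forall fun x => ?_))
        simp only [hw]
        rw [← Real.exp_add, Fintype.sum_prod_type, add_comm]
    · exact (hasSum_prod_pow_div_factorial fun e => Γ.edgeForm z e x).mul_right _
  have hgauss := integral_cexp_hermForm_mul_det (hz.norm_hermForm_kernelOn Finset.univ)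
  rw [← integral_comp_uncurry] at hgauss
  have hval : (∫ x : V → Spinor, Complex.exp (∑ e, Γ.edgeForm z e x) * (w x : ℂ))
      = (Real.pi : ℂ) ^ (2 * Fintype.card V) / (1 - Γ.kernelOn z Finset.univ).det := by
    rw [eq_div_iff (det_one_sub_ne_zero_of_hermForm_le (hz.norm_hermForm_kernelOn _))]
    rw [Fintype.card_prod, Fintype.card_fin, mul_comm (Fintype.card V)] at hgauss
    rw [← hgauss]
    congr 2
    ext x
    rw [sum_edgeForm, hw]
    simp only
    rw [Complex.ofReal_exp, ← Complex.exp_add, Fintype.sum_prod_type, add_comm]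
    push_cast
    rfl
  rw [hval] at hsum
  have hpi : (Real.pi : ℂ) ^ (2 * Fintype.card V) ≠ 0 :=
    pow_ne_zero _ (by exact_mod_cast Real.pi_ne_zero)
  have := hsum.div_const ((Real.pi : ℂ) ^ (2 * Fintype.card V))
  have h1 : Γ.genTerm z = fun n => (∫ x : V → Spinor,
      (∏ e, Γ.edgeForm z e x ^ n e / ((n e).factorial : ℂ)) * (w x : ℂ)) /
        (Real.pi : ℂ) ^ (2 * Fintype.card V) := by
    ext n
    rw [eq_div_iff hpi, genTerm_eq_integral]
  have h2 : 1 / (1 - Γ.kernelOn z Finset.univ).det = (Real.pi : ℂ) ^ (2 * Fintype.card V) /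
      (1 - Γ.kernelOn z Finset.univ).det / (Real.pi : ℂ) ^ (2 * Fintype.card V) := by
    rw [div_right_comm, div_self hpi]
  rw [h1, h2]
  exact this


open Classical

variable {V E : Type*} (Γ : OrientedGraph V E)

/-! ### Sums over collections of disjoint cycles inside a set of vertices -/

/-- A collection of pairwise vertex-disjoint cycles inside a set of vertices. -/
def IsDisjointIn (U : Finset V) (C : Finset Γ.NontrivialCycle) : Prop :=
  (∀ c ∈ C, c.verts ⊆ U) ∧ ∀ c ∈ C, ∀ c' ∈ C, c ≠ c' → Disjoint c.verts c'.verts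

/-- The sum of the amplitudes of the collections of disjoint cycles inside a set of vertices. -/
def cyclePolyOn [Finite E] (z : SpinorData E) (U : Finset V) : ℂ :=
  ∑ C : Finset Γ.NontrivialCycle with Γ.IsDisjointIn U C, unionAmp z C

variable {Γ}

theorem NontrivialCycle.verts_nonempty (c : Γ.NontrivialCycle) : c.verts.Nonempty := by
  induction c using Quotient.inductionOn with
  | h l =>
    obtain ⟨d, hd⟩ := List.exists_mem_of_ne_nil _ l.2.ne_nil
    exact ⟨Γ.start d, d, hd, Or.inl rfl⟩

/-- A shared edge would share its source vertex, in whichever direction it is traversed.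
Vertex-disjointness is therefore the only condition kept in `IsDisjointIn`. -/
theorem NontrivialCycle.disjoint_edges {c c' : Γ.NontrivialCycle} (h : Disjoint c.verts c'.verts) :
    Disjoint c.edges c'.edges := by
  induction c using Quotient.inductionOn with
  | h l =>
  induction c' using Quotient.inductionOn with
  | h l' =>
    rw [Set.disjoint_left] at h ⊢
    rintro e ⟨d, hd, rfl⟩ ⟨d', hd', he⟩
    refine h (a := Γ.src d.1) ⟨d, hd, ?_⟩ ⟨d', hd', ?_⟩
    · unfold start finish
      cases d.2 <;> simp
    · rw [← he]
      unfold start finish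
      cases d'.2 <;> simp

theorem cyclePolyOn_univ [Fintype V] [Finite E] (z : SpinorData E) :
    Γ.cyclePolyOn z Finset.univ = Γ.cyclePoly z := by
  have h : ∀ C : Finset Γ.NontrivialCycle, Γ.IsDisjointIn Finset.univ C ↔
      C = ∅ ∨ IsDisjointCycleUnion C := by
    intro C
    constructor
    · intro hC
      rcases C.eq_empty_or_nonempty with h | h
      · exact Or.inl h
      · exact Or.inr ⟨h, fun c hc c' hc' hne =>
          ⟨NontrivialCycle.disjoint_edges (hC.2 c hc c' hc' hne), hC.2 c hc c' hc' hne⟩⟩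
    · rintro (rfl | hC)
      · exact ⟨by simp, by simp⟩
      · exact ⟨by simp, fun c hc c' hc' hne => (hC.2 c hc c' hc' hne).2⟩
  unfold cyclePolyOn cyclePoly
  simp only [h]
  rw [Finset.filter_or, Finset.sum_union]
  · congr 1
    rw [Finset.filter_eq' Finset.univ ∅]
    simp [unionAmp]
  · rw [Finset.disjoint_filter]
    rintro C _ rfl h
    exact Finset.not_nonempty_empty h.1

theorem cyclePolyOn_empty [Finite E] (z : SpinorData E) : Γ.cyclePolyOn z ∅ = 1 := by
  unfold cyclePolyOn
  rw [Finset.sum_eq_single ∅]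
  · simp [unionAmp]
  · intro C hC hne
    obtain ⟨c, hc⟩ := Finset.nonempty_iff_ne_empty.mpr hne
    have := (Finset.mem_filter.mp hC).2.1 c hc
    obtain ⟨v, hv⟩ := c.verts_nonempty
    simpa using this hv
  · intro h
    exact absurd (Finset.mem_filter.mpr ⟨Finset.mem_univ _, by simp, by simp⟩) h

/-- Splitting off the cycle through a vertex. -/
theorem cyclePolyOn_insert [Finite E] (z : SpinorData E) {S : Finset V} {u : V} (hu : u ∉ S) :
    Γ.cyclePolyOn z (insert u S) = Γ.cyclePolyOn z S +
      ∑ c : Γ.NontrivialCycle with u ∈ c.verts ∧ c.verts ⊆ ((insert u S : Finset V) : Set V),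
        cycleAmp z c * Γ.cyclePolyOn z ((insert u S).filter (· ∉ c.verts)) := by
  have hsplit := Finset.sum_filter_add_sum_filter_not
    (Finset.univ.filter fun C : Finset Γ.NontrivialCycle => Γ.IsDisjointIn (insert u S) C)
    (fun C => ∀ c ∈ C, u ∉ c.verts) (unionAmp z)
  have h0 : Γ.cyclePolyOn z (insert u S) =
    ∑ C : Finset Γ.NontrivialCycle with Γ.IsDisjointIn (insert u S) C, unionAmp z C := rfl
  rw [h0, ← hsplit]
  congr 1
  · unfold cyclePolyOn
    rw [Finset.filter_filter]
    refine Finset.sum_congr (Finset.filter_congr fun C _ => ?_) fun _ _ => rfl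
    constructor
    · rintro ⟨⟨h1, h2⟩, h3⟩
      refine ⟨fun c hc v hv => ?_, h2⟩
      have := h1 c hc hv
      simp only [Finset.coe_insert, Set.mem_insert_iff, Finset.mem_coe] at this
      rcases this with rfl | h
      · exact absurd hv (h3 c hc)
      · exact h
    · rintro ⟨h1, h2⟩
      refine ⟨⟨fun c hc => (h1 c hc).trans (by simp), h2⟩, fun c hc huc => hu (h1 c hc huc)⟩
  · rw [Finset.filter_filter]
    unfold cyclePolyOn
    simp only [Finset.mul_sum]
    rw [Finset.sum_sigma']
    symm
    have key : ∀ (c : Γ.NontrivialCycle) (C : Finset Γ.NontrivialCycle),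
        Γ.IsDisjointIn ((insert u S).filter (· ∉ c.verts)) C → u ∈ c.verts →
          ∀ c' ∈ C, Disjoint c.verts c'.verts := by
      intro c C hC _ c' hc'
      rw [Set.disjoint_left]
      intro v hv hv'
      have := hC.1 c' hc' hv'
      simp only [Finset.coe_filter, Set.mem_ofPred_eq] at this
      exact this.2 hv
    have key2 : ∀ (c : Γ.NontrivialCycle) (C : Finset Γ.NontrivialCycle),
        Γ.IsDisjointIn ((insert u S).filter (· ∉ c.verts)) C → u ∈ c.verts → ∀ c' ∈ C, u ∉ c'.verts :=
      fun c C hC huc c' hc' h => Set.disjoint_left.mp (key c C hC huc c' hc') huc h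
    -- In a disjoint collection meeting `u`, the cycle `c` is recovered as the only member through
    -- `u`, which makes the map injective.
    refine Finset.sum_bij (fun p _ => insert p.1 p.2) ?_ ?_ ?_ ?_
    · rintro ⟨c, C⟩ hp
      simp only [Finset.mem_sigma, Finset.mem_filter, Finset.mem_univ, true_and] at hp ⊢
      obtain ⟨⟨huc, hcU⟩, hC⟩ := hp
      refine ⟨⟨?_, ?_⟩, ?_⟩
      · intro c' hc'
        rcases Finset.mem_insert.mp hc' with rfl | h
        · exact hcU
        · exact (hC.1 c' h).trans (Finset.coe_subset.mpr (Finset.filter_subset _ _))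
      · intro c1 h1 c2 h2 hne
        rcases Finset.mem_insert.mp h1 with e1 | h1 <;> rcases Finset.mem_insert.mp h2 with e2 | h2
        · exact absurd (e1.trans e2.symm) hne
        · exact e1 ▸ key c C hC huc c2 h2
        · exact e2 ▸ (key c C hC huc c1 h1).symm
        · exact hC.2 _ h1 _ h2 hne
      · intro h
        exact h c (Finset.mem_insert_self _ _) huc
    · rintro ⟨c, C⟩ hp ⟨c', C'⟩ hp' heq
      simp only [Finset.mem_sigma, Finset.mem_filter, Finset.mem_univ, true_and] at hp hp' heq
      have hcC : c ∉ C := fun h => key2 c C hp.2 hp.1.1 c h hp.1.1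
      have hcC' : c' ∉ C' := fun h => key2 c' C' hp'.2 hp'.1.1 c' h hp'.1.1
      have hcc : c = c' := by
        have : c ∈ insert c' C' := heq ▸ Finset.mem_insert_self c C
        rcases Finset.mem_insert.mp this with h | h
        · exact h
        · exact absurd hp.1.1 (key2 c' C' hp'.2 hp'.1.1 c h)
      subst hcc
      have : C = C' := by
        rw [← Finset.erase_insert hcC, heq, Finset.erase_insert hcC']
      rw [this]
    · intro C hC
      simp only [Finset.mem_filter, Finset.mem_univ, true_and, not_forall, not_not] at hC
      obtain ⟨hC, c, hc, huc⟩ := hC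
      refine ⟨⟨c, C.erase c⟩, ?_, Finset.insert_erase hc⟩
      simp only [Finset.mem_sigma, Finset.mem_filter, Finset.mem_univ, true_and]
      refine ⟨⟨huc, hC.1 c hc⟩, ?_, ?_⟩
      · intro c' hc' v hv
        obtain ⟨hne, hc'⟩ := Finset.mem_erase.mp hc'
        simp only [Finset.coe_filter, Set.mem_ofPred_eq]
        exact ⟨by simpa using hC.1 c' hc' hv, fun h =>
          Set.disjoint_left.mp (hC.2 c' hc' c hc hne) hv h⟩
      · intro c1 h1 c2 h2 hne
        exact hC.2 _ (Finset.mem_of_mem_erase h1) _ (Finset.mem_of_mem_erase h2) hne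
    · rintro ⟨c, C⟩ hp
      simp only [Finset.mem_sigma, Finset.mem_filter, Finset.mem_univ, true_and] at hp
      have hcC : c ∉ C := fun h => key2 c C hp.2 hp.1.1 c h hp.1.1
      simp only [unionAmp]
      rw [Finset.prod_insert hcC]

/-! ### Traversals based at a vertex -/

theorem listVerts_eq {l : List (DirEdge E)} (hl : l.map Γ.finish = (l.map Γ.start).rotate 1) :
    Γ.listVerts l = {v | v ∈ l.map Γ.start} := by
  ext v
  simp only [listVerts, Set.mem_ofPred_eq]
  constructor
  · rintro ⟨d, hd, h | h⟩
    · exact List.mem_map.mpr ⟨d, hd, h⟩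
    · rw [← List.mem_rotate (n := 1), ← hl]
      exact List.mem_map.mpr ⟨d, hd, h⟩
  · intro h
    obtain ⟨d, hd, h⟩ := List.mem_map.mp h
    exact ⟨d, hd, Or.inl h⟩

theorem IsCycleList.rotate {l : List (DirEdge E)} (hl : Γ.IsCycleList l) (k : ℕ) :
    Γ.IsCycleList (l.rotate k) where
  ne_nil := by simpa using hl.ne_nil
  closed := by
    rw [List.map_rotate, List.map_rotate, hl.closed, List.rotate_rotate, List.rotate_rotate,
      add_comm]
  edges_nodup := by
    rw [List.map_rotate]
    exact List.nodup_rotate.mpr hl.edges_nodup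
  starts_nodup := by
    rw [List.map_rotate]
    exact List.nodup_rotate.mpr hl.starts_nodup

theorem start_rev (d : DirEdge E) : Γ.start d.rev = Γ.finish d := by
  unfold start finish DirEdge.rev
  cases d.2 <;> simp

theorem finish_rev (d : DirEdge E) : Γ.finish d.rev = Γ.start d := by
  unfold start finish DirEdge.rev
  cases d.2 <;> simp

theorem map_start_revList (l : List (DirEdge E)) :
    (revList l).map Γ.start = (l.map Γ.finish).reverse := by
  simp [revList, List.map_reverse, Function.comp_def, start_rev]

theorem map_finish_revList (l : List (DirEdge E)) :
    (revList l).map Γ.finish = (l.map Γ.start).reverse := by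
  simp [revList, List.map_reverse, Function.comp_def, finish_rev]

theorem map_fst_revList (l : List (DirEdge E)) :
    (revList l).map Prod.fst = (l.map Prod.fst).reverse := by
  simp [revList, List.map_reverse, Function.comp_def, DirEdge.rev]

theorem IsCycleList.revList {l : List (DirEdge E)} (hl : Γ.IsCycleList l) :
    Γ.IsCycleList (revList l) where
  ne_nil := by
    have := hl.ne_nil
    simpa [OrientedGraph.revList] using this
  closed := by
    rw [map_start_revList, map_finish_revList, hl.closed]
    obtain ⟨d, l', rfl⟩ := List.exists_cons_of_ne_nil hl.ne_nil
    simp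
  edges_nodup := by
    rw [map_fst_revList]
    exact List.nodup_reverse.mpr hl.edges_nodup
  starts_nodup := by
    rw [map_start_revList, hl.closed]
    exact List.nodup_reverse.mpr (List.nodup_rotate.mpr hl.starts_nodup)

/-- The first vertex of a traversal. -/
def IsBasedAt (Γ : OrientedGraph V E) (u : V) (l : List (DirEdge E)) : Prop :=
  (l.map Γ.start).head? = some u

theorem IsCycleList.revList_isBasedAt {l : List (DirEdge E)} (hl : Γ.IsCycleList l) {u : V}
    (h : Γ.IsBasedAt u l) : Γ.IsBasedAt u (OrientedGraph.revList l) := by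
  unfold IsBasedAt at *
  rw [map_start_revList, hl.closed]
  obtain ⟨d, l', rfl⟩ := List.exists_cons_of_ne_nil hl.ne_nil
  simpa using h

/-- The starting vertices are distinct, so only the trivial rotation keeps `u` in front. -/
theorem IsCycleList.eq_of_isRotated {l l' : List (DirEdge E)} (hl : Γ.IsCycleList l) {u : V}
    (h : Γ.IsBasedAt u l) (h' : Γ.IsBasedAt u l') (hr : l ~r l') : l = l' := by
  obtain ⟨k, rfl⟩ := hr
  unfold IsBasedAt at *
  have hn : 0 < l.length := List.length_pos_iff.mpr hl.ne_nil
  have hk : k % l.length < (l.map Γ.start).length := by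
    rw [List.length_map]
    exact Nat.mod_lt _ hn
  rw [← List.rotate_mod] at h' ⊢
  rw [List.map_rotate, List.head?_rotate hk, ← h, List.head?_eq_getElem?] at h'
  have := (List.getElem?_inj hk hl.starts_nodup).mp h'
  rw [this, List.rotate_zero]

/-- Otherwise the list would contain an edge together with its reverse. Hence each cycle has two
different traversals from a given vertex, even when it is a single loop. -/
theorem IsCycleList.ne_revList {l : List (DirEdge E)} (hl : Γ.IsCycleList l) :
    l ≠ OrientedGraph.revList l := by
  intro h
  obtain ⟨d, hd⟩ := List.exists_mem_of_ne_nil _ hl.ne_nil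
  have hd' : d.rev ∈ l := by
    rw [h]
    simp only [OrientedGraph.revList, List.mem_reverse]
    exact List.mem_map_of_mem hd
  have := List.inj_on_of_nodup_map hl.edges_nodup hd hd' rfl
  have := congrArg Prod.snd this
  simp [DirEdge.rev] at this


open Classical

section Paths

variable {V E : Type*} (Γ : OrientedGraph V E)

/-! ### Sums over paths -/

/-- The sign of a directed edge. -/
def dirSign (d : DirEdge E) : ℂ := if d.2 then 1 else -1

/-- The amplitude of a path that continues the directed edge `b` and is closed by a spinor `y`. -/
def pathWeight (z : SpinorData E) (y : Spinor) : DirEdge E → List (DirEdge E) → ℂ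
  | b, [] => bracket y (z b.rev)
  | b, d :: l => dirSign d * bracket (z d) (z b.rev) * pathWeight z y d l

/-- Swapping the arguments of every bracket costs one sign per edge. Combined with `(-1) ^ |e|`,
this leaves a minus sign for each edge traversed against its orientation, the same sign as in
`dirKernel`. -/
theorem listAmp_cons (z : SpinorData E) (d : DirEdge E) (l : List (DirEdge E)) :
    listAmp z (d :: l) = -(dirSign d * pathWeight z (z d) d l) := by
  have h : ∀ (e b : DirEdge E) (l : List (DirEdge E)), (-1) ^ (l.countP fun d => d.2) *
      (List.zipWith (fun d d' => bracket (z d.rev) (z d')) (b :: l) (l ++ [e])).prod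
        = -pathWeight z (z e) b l := by
    intro e b l
    induction l generalizing b with
    | nil => simp [pathWeight, bracket_swap (z e)]
    | cons d l ih =>
      rw [List.cons_append, List.zipWith_cons_cons, List.prod_cons, pathWeight, List.countP_cons,
        pow_add, bracket_swap (z d), dirSign]
      have := ih d
      split_ifs
      · linear_combination (-bracket (z b.rev) (z d)) * this
      · linear_combination (bracket (z b.rev) (z d)) * this
  unfold listAmp
  have h1 := h d d l
  rw [List.rotate_cons_succ, List.rotate_zero, List.countP_cons, pow_add, dirSign]
  split_ifs
  · linear_combination h1
  · linear_combination -h1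

section
variable {Γ}

theorem bracket_self (w : Spinor) : bracket w w = 0 := by
  unfold bracket; ring

/-- A closed path that uses an edge in both directions has amplitude zero. -/
theorem listAmp_eq_zero (z : SpinorData E) {l : List (DirEdge E)}
    (h1 : l.map Γ.finish = (l.map Γ.start).rotate 1) (h2 : (l.map Γ.start).Nodup)
    (h3 : ¬(l.map Prod.fst).Nodup) : listAmp z l = 0 := by
  have hl : l.Nodup := List.Nodup.of_map _ h2
  obtain ⟨d, hd, d', hd', hne, heq⟩ : ∃ d ∈ l, ∃ d' ∈ l, d ≠ d' ∧ d.1 = d'.1 := by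
    by_contra hcon
    push Not at hcon
    refine h3 (List.Nodup.map_on (fun d hd d' hd' he => ?_) hl)
    by_contra hne
    exact hcon d hd d' hd' hne he
  have hrev : d' = d.rev := by
    obtain ⟨e, s⟩ := d
    obtain ⟨e', s'⟩ := d'
    simp only at heq
    subst heq
    have : s ≠ s' := fun h => hne (by rw [h])
    cases s <;> cases s' <;> simp_all [DirEdge.rev]
  obtain ⟨i, hi, rfl⟩ := List.mem_iff_getElem.mp hd
  have hn : 0 < l.length := by omega
  have hj : (i + 1) % l.length < l.length := Nat.mod_lt _ hn
  have hstep : Γ.finish l[i] = Γ.start (l[(i + 1) % l.length]) := by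
    have := congrArg (fun k => k[i]?) h1
    rw [List.getElem?_rotate (by simpa using hi)] at this
    simpa [hi, hj] using this
  -- The reverse of `d` starts where `d` ends; as starts are distinct, it must be the cyclic
  -- successor of `d`, and their bracket is `[z|z⟩ = 0`.
  have hd'eq : d' = l[(i + 1) % l.length] :=
    List.inj_on_of_nodup_map h2 hd' (List.getElem_mem _) (by rw [hrev, start_rev, hstep])
  unfold listAmp
  rw [List.prod_eq_zero, mul_zero]
  rw [List.mem_iff_getElem]
  refine ⟨i, by simpa using hi, ?_⟩
  rw [List.getElem_zipWith, List.getElem_rotate, ← hd'eq, hrev, bracket_self]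

end

variable [Fintype E]

/-- The paths inside `S` that continue the directed edge `b` and end at the vertex `u`. -/
def pathLists (u : V) (S : Finset V) (b : DirEdge E) : Finset (List (DirEdge E)) :=
  if Γ.finish b = u then {[]}
  else if h : Γ.finish b ∈ S then
    (Finset.univ.filter fun d => Γ.start d = Γ.finish b).biUnion fun d =>
      (pathLists u (S.erase (Γ.finish b)) d).image (List.cons d)
  else ∅
termination_by S.card
decreasing_by exact Finset.card_erase_lt_of_mem h

variable {Γ}

/-- Since `u ∉ S`, stopping at the first arrival at `u` loses no path, and erasing visited vertices
from `S` is the same as having distinct starts. -/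
theorem mem_pathLists {u : V} {l : List (DirEdge E)} : ∀ {S : Finset V} {b : DirEdge E}, u ∉ S →
    (l ∈ Γ.pathLists u S b ↔ (b :: l).map Γ.finish = l.map Γ.start ++ [u] ∧
      (l.map Γ.start).Nodup ∧ ∀ d ∈ l, Γ.start d ∈ S) := by
  induction l with
  | nil =>
    intro S b hu
    rw [pathLists]
    split_ifs with h1 h2
    · simp [h1]
    · simp [h1]
    · simp [h1]
  | cons d l ih =>
    intro S b hu
    rw [pathLists]
    split_ifs with h1 h2
    · simp only [Finset.mem_singleton, reduceCtorEq, false_iff]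
      rintro ⟨h, -, h3⟩
      simp only [List.map_cons, List.cons_append, List.cons.injEq] at h
      refine hu ?_
      rw [← h1, h.1]
      exact h3 d (by simp)
    · have hu' : u ∉ S.erase (Γ.finish b) := fun h => hu (Finset.mem_of_mem_erase h)
      simp only [Finset.mem_biUnion, Finset.mem_filter, Finset.mem_univ, true_and,
        Finset.mem_image, List.cons.injEq]
      constructor
      · rintro ⟨d', hd', l', hl', rfl, rfl⟩
        obtain ⟨e1, e2, e3⟩ := (ih hu').mp hl'
        refine ⟨?_, ?_, ?_⟩
        · rw [List.map_cons, e1, List.map_cons, hd', List.cons_append]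
        · rw [List.map_cons, List.nodup_cons]
          refine ⟨fun h => ?_, e2⟩
          obtain ⟨d, hd, hds⟩ := List.mem_map.mp h
          have := e3 d hd
          rw [hds, hd'] at this
          simp at this
        · intro d hd
          rcases List.mem_cons.mp hd with rfl | hd
          · rw [hd']; exact h2
          · exact Finset.mem_of_mem_erase (e3 d hd)
      · rintro ⟨e1, e2, e3⟩
        simp only [List.map_cons, List.cons_append, List.cons.injEq] at e1
        rw [List.map_cons, List.nodup_cons] at e2
        refine ⟨d, e1.1.symm, l, (ih hu').mpr ⟨e1.2, e2.2, fun d' hd' => ?_⟩, rfl, rfl⟩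
        refine Finset.mem_erase.mpr ⟨fun h => e2.1 ?_, e3 d' (by simp [hd'])⟩
        rw [← e1.1, ← h]
        exact List.mem_map_of_mem hd'
    · simp only [Finset.notMem_empty, false_iff]
      rintro ⟨h, -, h3⟩
      simp only [List.map_cons, List.cons_append, List.cons.injEq] at h
      refine h2 ?_
      rw [h.1]
      exact h3 d (by simp)

/-- The sum over the paths that continue the directed edge `b` inside `S` and end at `u`, each
weighted by the collections of disjoint cycles that avoid the path. -/
def pathSum (z : SpinorData E) (u : V) (S : Finset V) (y : Spinor) (b : DirEdge E) : ℂ :=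
  ∑ l ∈ Γ.pathLists u S b, pathWeight z y b l *
    Γ.cyclePolyOn z (S.filter (· ∉ l.map Γ.start))

theorem pathSum_of_finish_eq (z : SpinorData E) {u : V} (S : Finset V) (y : Spinor) {b : DirEdge E}
    (h : Γ.finish b = u) :
    Γ.pathSum z u S y b = bracket y (z b.rev) * Γ.cyclePolyOn z S := by
  rw [pathSum, pathLists, if_pos h]
  simp [pathWeight]

theorem pathSum_of_notMem (z : SpinorData E) {u : V} (S : Finset V) (y : Spinor) {b : DirEdge E}
    (h : Γ.finish b ≠ u) (h' : Γ.finish b ∉ S) : Γ.pathSum z u S y b = 0 := by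
  rw [pathSum, pathLists, if_neg h, dif_neg h', Finset.sum_empty]

/-- Splitting off the first edge leaves the weights of the avoiding cycles unchanged, because its
starting vertex has been removed from `S`. The matrix counterpart is
`vertProj_mul_resolvent_insert`. -/
theorem pathSum_of_mem (z : SpinorData E) {u : V} (S : Finset V) (y : Spinor) {b : DirEdge E}
    (h : Γ.finish b ≠ u) (h' : Γ.finish b ∈ S) :
    Γ.pathSum z u S y b = ∑ d with Γ.start d = Γ.finish b,
      dirSign d * bracket (z d) (z b.rev) * Γ.pathSum z u (S.erase (Γ.finish b)) y d := by
  rw [pathSum, pathLists, if_neg h, dif_pos h', Finset.sum_biUnion]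
  · refine Finset.sum_congr rfl fun d hd => ?_
    rw [Finset.sum_image (fun _ _ _ _ h => (List.cons.inj h).2), pathSum, Finset.mul_sum]
    refine Finset.sum_congr rfl fun l _ => ?_
    rw [pathWeight, mul_assoc]
    congr 3
    ext v
    simp only [Finset.mem_filter, Finset.mem_univ, true_and] at hd
    simp only [Finset.mem_filter, Finset.mem_erase, List.map_cons, List.mem_cons, hd]
    tauto
  · intro d _ d' _ hne
    rw [Function.onFun, Finset.disjoint_left]
    intro l hl hl'
    obtain ⟨a, -, rfl⟩ := Finset.mem_image.mp hl
    obtain ⟨a', -, h⟩ := Finset.mem_image.mp hl'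
    exact hne (List.cons.inj h).1.symm

variable (Γ) in
/-- The closed paths based at a vertex `u` that pass through other vertices of `S` at most once. -/
def closedLists (u : V) (S : Finset V) : Finset (List (DirEdge E)) :=
  (Finset.univ.filter fun d => Γ.start d = u).biUnion fun d =>
    (Γ.pathLists u S d).image (List.cons d)

theorem mem_closedLists {u : V} {S : Finset V} (hu : u ∉ S) {l : List (DirEdge E)} :
    l ∈ Γ.closedLists u S ↔ Γ.IsBasedAt u l ∧ l.map Γ.finish = (l.map Γ.start).rotate 1 ∧
      (l.map Γ.start).Nodup ∧ ∀ d ∈ l, Γ.start d ∈ insert u S := by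
  simp only [closedLists, Finset.mem_biUnion, Finset.mem_filter, Finset.mem_univ, true_and,
    Finset.mem_image]
  constructor
  · rintro ⟨d, hd, l', hl', rfl⟩
    obtain ⟨e1, e2, e3⟩ := (mem_pathLists hu).mp hl'
    refine ⟨by simp [IsBasedAt, hd], ?_, ?_, ?_⟩
    · rw [e1, List.map_cons, List.rotate_cons_succ, List.rotate_zero, hd]
    · rw [List.map_cons, List.nodup_cons]
      refine ⟨fun h => ?_, e2⟩
      obtain ⟨d', hd', hds⟩ := List.mem_map.mp h
      have := e3 d' hd'
      rw [hds, hd] at this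
      exact hu this
    · intro d' hd'
      rcases List.mem_cons.mp hd' with rfl | hd'
      · simp [hd]
      · exact Finset.mem_insert_of_mem (e3 d' hd')
  · rintro ⟨h, e1, e2, e3⟩
    rcases l with _ | ⟨d, l⟩
    · simp [IsBasedAt] at h
    · have hd : Γ.start d = u := by simpa [IsBasedAt] using h
      refine ⟨d, hd, l, (mem_pathLists hu).mpr ⟨?_, ?_, ?_⟩, rfl⟩
      · rw [e1, List.map_cons, List.rotate_cons_succ, List.rotate_zero, hd]
      · rw [List.map_cons, List.nodup_cons] at e2
        exact e2.2
      · intro d' hd'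
        rcases Finset.mem_insert.mp (e3 d' (by simp [hd'])) with h | h
        · rw [List.map_cons, List.nodup_cons] at e2
          refine absurd ?_ e2.1
          rw [hd, ← h]
          exact List.mem_map_of_mem hd'
        · exact h

/-- In each of the two directions exactly one rotation starts at `u`, and the two resulting lists
differ. -/
theorem card_based_traversals {u : V} {S : Finset V} (hu : u ∉ S) {c : Γ.NontrivialCycle}
    (huc : u ∈ c.verts) (hc : c.verts ⊆ ((insert u S : Finset V) : Set V)) :
    (((Γ.closedLists u S).subtype Γ.IsCycleList).filter
      fun l => (Quotient.mk Γ.cycleSetoid l : Γ.NontrivialCycle) = c).card = 2 := by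
  obtain ⟨l, hlc⟩ := Quotient.exists_rep c
  have huc' : u ∈ Γ.listVerts l.1 := by rwa [← hlc] at huc
  have hc' : Γ.listVerts l.1 ⊆ ((insert u S : Finset V) : Set V) := by rwa [← hlc] at hc
  rw [listVerts_eq l.2.closed] at huc' hc'
  obtain ⟨i, hi, hiu⟩ := List.mem_iff_getElem.mp huc'
  have hil : i < l.1.length := by simpa using hi
  set m := l.1.rotate i with hm
  have hmc : Γ.IsCycleList m := l.2.rotate i
  have hmu : Γ.IsBasedAt u m := by
    unfold IsBasedAt
    rw [hm, List.map_rotate, List.head?_rotate hi, List.getElem?_eq_getElem hi, hiu]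
  have hlm : l.1 ~r m := ⟨i, rfl⟩
  have hmS : ∀ d ∈ m, Γ.start d ∈ insert u S := fun d hd =>
    hc' (List.mem_map_of_mem (hlm.mem_iff.mpr hd))
  have hrS : ∀ d ∈ revList m, Γ.start d ∈ insert u S := fun d hd => by
    have h1 : Γ.start d ∈ (revList m).map Γ.start := List.mem_map_of_mem hd
    rw [map_start_revList, List.mem_reverse, hmc.closed, List.mem_rotate] at h1
    obtain ⟨d', hd', he⟩ := List.mem_map.mp h1
    rw [← he]
    exact hmS d' hd'
  have : (((Γ.closedLists u S).subtype Γ.IsCycleList).filter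
      fun l' => (Quotient.mk Γ.cycleSetoid l' : Γ.NontrivialCycle) = c)
      = {⟨m, hmc⟩, ⟨revList m, hmc.revList⟩} := by
    ext ⟨l', hl'⟩
    simp only [Finset.mem_filter, Finset.mem_subtype, mem_closedLists hu, Finset.mem_insert,
      Finset.mem_singleton, Subtype.mk.injEq]
    constructor
    · rintro ⟨⟨hb, -⟩, heq⟩
      have hsame : SameCycle l' l.1 := Quotient.exact (heq.trans hlc.symm)
      rcases hsame with h | h
      · exact Or.inl (hl'.eq_of_isRotated hb hmu (h.trans hlm))
      · right
        have := hl'.revList.eq_of_isRotated (hl'.revList_isBasedAt hb) hmu (h.trans hlm)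
        rw [← this, revList_revList]
    · rintro (rfl | rfl)
      · exact ⟨⟨hmu, hmc.closed, hmc.starts_nodup, fun d hd => Finset.mem_insert.mp (hmS d hd)⟩,
          (Quotient.sound (show SameCycle _ _ from Or.inl hlm.symm)).trans hlc⟩
      · refine ⟨⟨hmc.revList_isBasedAt hmu, hmc.revList.closed, hmc.revList.starts_nodup,
          fun d hd => Finset.mem_insert.mp (hrS d hd)⟩,
          (Quotient.sound (show SameCycle _ _ from Or.inr ?_)).trans hlc⟩
        rw [revList_revList]
        exact hlm.symm
  rw [this, Finset.card_pair]
  intro h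
  exact hmc.ne_revList (congrArg Subtype.val h)

/-- The cycles through a vertex, as closed paths based at the vertex. -/
theorem two_mul_cyclePolyOn_insert (z : SpinorData E) {u : V} {S : Finset V} (hu : u ∉ S) :
    2 * Γ.cyclePolyOn z (insert u S) = 2 * Γ.cyclePolyOn z S -
      ∑ d with Γ.start d = u, dirSign d * Γ.pathSum z u S (z d) d := by
  have h1 : -∑ d with Γ.start d = u, dirSign d * Γ.pathSum z u S (z d) d =
      ∑ l ∈ Γ.closedLists u S, listAmp z l *
        Γ.cyclePolyOn z ((insert u S).filter (· ∉ l.map Γ.start)) := by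
    rw [closedLists, Finset.sum_biUnion, ← Finset.sum_neg_distrib]
    · refine Finset.sum_congr rfl fun d hd => ?_
      simp only [Finset.mem_filter, Finset.mem_univ, true_and] at hd
      rw [Finset.sum_image (fun _ _ _ _ h => (List.cons.inj h).2), pathSum, Finset.mul_sum,
        ← Finset.sum_neg_distrib]
      refine Finset.sum_congr rfl fun l _ => ?_
      have : (insert u S).filter (· ∉ (d :: l).map Γ.start) = S.filter (· ∉ l.map Γ.start) := by
        ext v
        simp only [Finset.mem_filter, Finset.mem_insert, List.map_cons, List.mem_cons, hd]
        constructor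
        · tauto
        · rintro ⟨h1, h2⟩
          exact ⟨Or.inr h1, fun h => h.elim (fun h => hu (h ▸ h1)) h2⟩
      rw [this, listAmp_cons]
      ring
    · intro d _ d' _ hne
      rw [Function.onFun, Finset.disjoint_left]
      intro l hl hl'
      obtain ⟨a, -, rfl⟩ := Finset.mem_image.mp hl
      obtain ⟨a', -, h⟩ := Finset.mem_image.mp hl'
      exact hne (List.cons.inj h).1.symm
  rw [sub_eq_add_neg, h1, cyclePolyOn_insert z hu, mul_add]
  congr 1
  -- Closed paths using an edge in both directions are not cycles, but they enter with amplitude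
  -- zero.
  have h2 : ∑ l ∈ Γ.closedLists u S, listAmp z l *
        Γ.cyclePolyOn z ((insert u S).filter (· ∉ l.map Γ.start)) =
      ∑ l ∈ (Γ.closedLists u S).filter Γ.IsCycleList, listAmp z l *
        Γ.cyclePolyOn z ((insert u S).filter (· ∉ l.map Γ.start)) := by
    symm
    refine Finset.sum_subset (Finset.filter_subset _ _) fun l hl hl' => ?_
    obtain ⟨e1, e2, e3, -⟩ := (mem_closedLists hu).mp hl
    rw [listAmp_eq_zero z e2 e3, zero_mul]
    refine fun h => hl' (Finset.mem_filter.mpr ⟨hl, ?_, e2, h, e3⟩)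
    rintro rfl
    simp [IsBasedAt] at e1
  have h3 := Finset.sum_subtype_eq_sum_filter (s := Γ.closedLists u S) (p := Γ.IsCycleList)
    fun l => listAmp z l * Γ.cyclePolyOn z ((insert u S).filter (· ∉ l.map Γ.start))
  -- Grouping the based traversals by their cycle gives fibres of size two, whence the factor `2`.
  rw [h2, ← h3, ← Finset.sum_fiberwise_of_maps_to
    (t := Finset.univ.filter fun c : Γ.NontrivialCycle =>
      u ∈ c.verts ∧ c.verts ⊆ ((insert u S : Finset V) : Set V))
    (g := fun l => (Quotient.mk Γ.cycleSetoid l : Γ.NontrivialCycle)), Finset.mul_sum]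
  · refine Finset.sum_congr rfl fun c hc => ?_
    simp only [Finset.mem_filter, Finset.mem_univ, true_and] at hc
    rw [two_mul, ← two_nsmul, ← card_based_traversals hu hc.1 hc.2, ← Finset.sum_const]
    refine Finset.sum_congr rfl fun l hl => ?_
    have hlc := (Finset.mem_filter.mp hl).2
    subst hlc
    congr 2
    ext v
    have : v ∈ NontrivialCycle.verts (Quotient.mk Γ.cycleSetoid l) ↔ v ∈ l.1.map Γ.start := by
      change v ∈ Γ.listVerts l.1 ↔ _
      rw [listVerts_eq l.2.closed]
      rfl
    simp only [Finset.mem_filter, this]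
  · rintro ⟨l, hlc⟩ hl
    obtain ⟨e1, e2, e3, e4⟩ := (mem_closedLists hu).mp (Finset.mem_subtype.mp hl)
    refine Finset.mem_filter.mpr ⟨Finset.mem_univ _, ?_⟩
    change u ∈ Γ.listVerts l ∧ Γ.listVerts l ⊆ _
    rw [listVerts_eq e2]
    constructor
    · exact List.mem_of_head? e1
    · intro v hv
      obtain ⟨d, hd, rfl⟩ := List.mem_map.mp hv
      exact e4 d hd

end Paths

end SpinNetwork.OrientedGraph

/-! ### Block elimination with orthogonal idempotents `P` (old block) and `E` (new block) and the
resolvent `G` of `P * K * P`. -/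

section Ring

variable {R : Type*} [Ring R] [Algebra ℂ R] {K P E G : R} {c : ℂ}

/-- The block elimination identity for the row of a resolvent. -/
theorem schur_row (hE : E * E = E) (hEP : E * P = 0) (hPE : P * E = 0)
    (hGP : G * P = G) (hG : G - G * K * P = P)
    (hc : E * K * E + E * K * G * K * E = (1 - c) • E) :
    (E + E * K * G) * (1 - (P + E) * K * (P + E)) = c • E := by
  have hGE : G * E = 0 := by rw [← hGP, mul_assoc, hPE, mul_zero]
  have h1 : G * K * P = G - P := eq_sub_iff_add_eq'.mpr (sub_eq_iff_eq_add.mp hG).symm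
  have e1 : (E + E * K * G) * (P + E) = E + E * K * G := by
    simp only [add_mul, mul_add, mul_assoc, hE, hEP, hGP, hGE, mul_zero]
    abel
  have e2 : (E + E * K * G) * K * (P + E) = (1 - c) • E + E * K * G := by
    rw [← hc]
    have : E * K * G * K * P = E * K * G - E * K * P := by
      rw [mul_assoc (E * K), mul_assoc (E * K), h1, mul_sub]
    simp only [add_mul, mul_add, this]
    abel
  rw [mul_sub, mul_one, ← mul_assoc, ← mul_assoc, e1, e2, sub_smul, one_smul]
  abel

/-- The block elimination identity behind the factorization of the determinant. -/
theorem schur_factorization (hE : E * E = E) (hEP : E * P = 0) (hPE : P * E = 0)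
    (hPG : P * G = G) (hGP : G * P = G) (hG : G - G * K * P = P) (hG' : G - P * K * G = P)
    (hc : E * K * E + E * K * G * K * E = (1 - c) • E) :
    (1 + E * K * G) * (1 - (P + E) * K * (P + E)) =
      (1 - P * K * P) * (1 - E + c • E) * (1 - G * K * E) := by
  have hEG : E * G = 0 := by rw [← hPG, ← mul_assoc, hEP, zero_mul]
  have h1 : P * K * G = G - P := eq_sub_iff_add_eq'.mpr (sub_eq_iff_eq_add.mp hG').symm
  have e1 : (1 + E * K * G) * (1 - (P + E) * K * (P + E)) =
      c • E + (1 - E) * (1 - (P + E) * K * (P + E)) := by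
    rw [← schur_row hE hEP hPE hGP hG hc, ← add_mul]
    congr 1
    abel
  have e2 : (1 - E + c • E) * (1 - G * K * E) = 1 - E + c • E - G * K * E := by
    rw [mul_sub, mul_one]
    congr 1
    simp only [add_mul, sub_mul, one_mul, smul_mul_assoc, ← mul_assoc, hEG, smul_zero,
      sub_zero, add_zero]
  have e3 : P * K * P * (1 - E + c • E - G * K * E) = P * K * P - (G - P) * K * E := by
    have : P * K * P * (G * K * E) = P * K * G * K * E := by
      simp only [mul_assoc]
      rw [← mul_assoc P G, hPG]
    rw [mul_sub, this, h1]
    simp only [mul_add, mul_sub, mul_one, mul_smul_comm, mul_assoc, hPE, mul_zero, smul_zero,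
      sub_zero, add_zero]
  have e4 : (1 - E) * (P + E) = P := by
    simp only [sub_mul, one_mul, mul_add, hEP, hE]
    abel
  rw [e1, mul_assoc (1 - P * K * P), e2, sub_mul (1 : R) (P * K * P), e3, mul_sub (1 - E), mul_one,
    ← mul_assoc (1 - E), ← mul_assoc (1 - E), e4]
  simp only [sub_mul, mul_add, one_mul]
  abel

end Ring

namespace SpinNetwork.OrientedGraph

open Classical

/-! ### Resolvents restricted to vertex sets, and elimination of one vertex. -/

section Resolvent

variable {V : Type*}

/-- The projection onto the coordinates at a set of vertices. -/
def vertProj (S : Finset V) : Matrix (V × Fin 2) (V × Fin 2) ℂ :=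
  Matrix.diagonal fun a => if a.1 ∈ S then 1 else 0

theorem vertProj_empty : vertProj (∅ : Finset V) = 0 := by
  simp [vertProj]

theorem vertProj_insert {S : Finset V} {v : V} (hv : v ∉ S) :
    vertProj (insert v S) = vertProj S + vertProj {v} := by
  unfold vertProj
  rw [Matrix.diagonal_add]
  congr 1
  ext a
  by_cases h1 : a.1 = v
  · simp [h1, hv]
  · simp [h1]

variable [Fintype V]

theorem vertProj_univ : vertProj (Finset.univ : Finset V) = 1 := by
  simp [vertProj]

theorem vertProj_mul_vertProj (S T : Finset V) :
    vertProj S * vertProj T = vertProj (S ∩ T) := by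
  unfold vertProj
  rw [Matrix.diagonal_mul_diagonal]
  congr 1
  ext a
  by_cases h1 : a.1 ∈ S <;> by_cases h2 : a.1 ∈ T <;> simp [h1, h2]

theorem vertProj_mul_apply (S : Finset V) (M : Matrix (V × Fin 2) (V × Fin 2) ℂ) (a b) :
    (vertProj S * M) a b = if a.1 ∈ S then M a b else 0 := by
  simp [vertProj, Matrix.diagonal_mul]

theorem mul_vertProj_apply (S : Finset V) (M : Matrix (V × Fin 2) (V × Fin 2) ℂ) (a b) :
    (M * vertProj S) a b = if b.1 ∈ S then M a b else 0 := by
  simp [vertProj, Matrix.mul_diagonal]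

/-- The resolvent of the restriction of a matrix to a set of vertices. -/
def resolvent (K : Matrix (V × Fin 2) (V × Fin 2) ℂ) (S : Finset V) :
    Matrix (V × Fin 2) (V × Fin 2) ℂ :=
  vertProj S * (1 - vertProj S * K * vertProj S)⁻¹

variable {K : Matrix (V × Fin 2) (V × Fin 2) ℂ} {S : Finset V}

theorem vertProj_mul_self (S : Finset V) : vertProj S * vertProj S = vertProj S := by
  rw [vertProj_mul_vertProj, Finset.inter_self]

theorem vertProj_mul_resolvent : vertProj S * resolvent K S = resolvent K S := by
  rw [resolvent, ← mul_assoc, vertProj_mul_self]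

theorem resolvent_comm (h : (1 - vertProj S * K * vertProj S).det ≠ 0) :
    vertProj S * (1 - vertProj S * K * vertProj S)⁻¹ =
      (1 - vertProj S * K * vertProj S)⁻¹ * vertProj S := by
  have hu : IsUnit (1 - vertProj S * K * vertProj S).det := h.isUnit
  set H := 1 - vertProj S * K * vertProj S with hH
  have hcomm : H * vertProj S = vertProj S * H := by
    rw [hH, sub_mul, mul_sub, one_mul, mul_one, mul_assoc, vertProj_mul_self, ← mul_assoc,
      ← mul_assoc, vertProj_mul_self]
  calc vertProj S * H⁻¹ = H⁻¹ * H * (vertProj S * H⁻¹) := by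
        rw [Matrix.nonsing_inv_mul _ hu, one_mul]
    _ = H⁻¹ * (H * vertProj S) * H⁻¹ := by simp only [mul_assoc]
    _ = H⁻¹ * vertProj S * (H * H⁻¹) := by rw [hcomm]; simp only [mul_assoc]
    _ = H⁻¹ * vertProj S := by rw [Matrix.mul_nonsing_inv _ hu, mul_one]

theorem resolvent_mul_vertProj (h : (1 - vertProj S * K * vertProj S).det ≠ 0) :
    resolvent K S * vertProj S = resolvent K S := by
  rw [resolvent, resolvent_comm h, mul_assoc, vertProj_mul_self]

theorem resolvent_sub_left (h : (1 - vertProj S * K * vertProj S).det ≠ 0) :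
    resolvent K S - vertProj S * K * resolvent K S = vertProj S := by
  have h1 : (1 - vertProj S * K * vertProj S) * resolvent K S = vertProj S := by
    rw [resolvent, resolvent_comm h, ← mul_assoc, Matrix.mul_nonsing_inv _ h.isUnit, one_mul]
  rw [sub_mul, one_mul, mul_assoc _ (vertProj S), vertProj_mul_resolvent] at h1
  exact h1

theorem resolvent_mul (h : (1 - vertProj S * K * vertProj S).det ≠ 0) :
    resolvent K S * (1 - vertProj S * K * vertProj S) = vertProj S := by
  rw [resolvent, mul_assoc, Matrix.nonsing_inv_mul _ h.isUnit, mul_one]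

theorem resolvent_sub_right (h : (1 - vertProj S * K * vertProj S).det ≠ 0) :
    resolvent K S - resolvent K S * K * vertProj S = vertProj S := by
  have h1 := resolvent_mul h
  rw [mul_sub, mul_one, ← mul_assoc, ← mul_assoc, resolvent_mul_vertProj h] at h1
  exact h1

/-! ### Self-dual matrices -/

/-- The invariant symplectic form on the spinors at all vertices. -/
def sympl : Matrix (V × Fin 2) (V × Fin 2) ℂ := fun a b =>
  if a.1 = b.1 then (!![0, 1; -1, 0] : Matrix (Fin 2) (Fin 2) ℂ) a.2 b.2 else 0

theorem sympl_mul_apply_zero (M : Matrix (V × Fin 2) (V × Fin 2) ℂ) (v : V) (b) :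
    ((sympl : Matrix (V × Fin 2) (V × Fin 2) ℂ) * M) (v, 0) b = M (v, 1) b := by
  simp [Matrix.mul_apply, Fintype.sum_prod_type, sympl, Fin.sum_univ_two]

theorem sympl_mul_apply_one (M : Matrix (V × Fin 2) (V × Fin 2) ℂ) (v : V) (b) :
    ((sympl : Matrix (V × Fin 2) (V × Fin 2) ℂ) * M) (v, 1) b = -M (v, 0) b := by
  simp [Matrix.mul_apply, Fintype.sum_prod_type, sympl, Fin.sum_univ_two]

theorem mul_sympl_apply_zero (M : Matrix (V × Fin 2) (V × Fin 2) ℂ) (a) (v : V) :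
    (M * (sympl : Matrix (V × Fin 2) (V × Fin 2) ℂ)) a (v, 0) = -M a (v, 1) := by
  simp [Matrix.mul_apply, Fintype.sum_prod_type, sympl, Fin.sum_univ_two]

theorem mul_sympl_apply_one (M : Matrix (V × Fin 2) (V × Fin 2) ℂ) (a) (v : V) :
    (M * (sympl : Matrix (V × Fin 2) (V × Fin 2) ℂ)) a (v, 1) = M a (v, 0) := by
  simp [Matrix.mul_apply, Fintype.sum_prod_type, sympl, Fin.sum_univ_two]

/-- A matrix that is self-adjoint for the symplectic form. -/
def IsSelfDual (M : Matrix (V × Fin 2) (V × Fin 2) ℂ) : Prop :=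
  sympl * M.transpose = M * sympl

theorem IsSelfDual.add {M N : Matrix (V × Fin 2) (V × Fin 2) ℂ} (hM : IsSelfDual M)
    (hN : IsSelfDual N) : IsSelfDual (M + N) := by
  unfold IsSelfDual at *
  rw [Matrix.transpose_add, mul_add, add_mul, hM, hN]

theorem IsSelfDual.one_sub {M : Matrix (V × Fin 2) (V × Fin 2) ℂ} (hM : IsSelfDual M) :
    IsSelfDual (1 - M) := by
  unfold IsSelfDual at *
  rw [Matrix.transpose_sub, Matrix.transpose_one, mul_sub, sub_mul, hM, mul_one, one_mul]

theorem IsSelfDual.conj {M N : Matrix (V × Fin 2) (V × Fin 2) ℂ} (hM : IsSelfDual M)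
    (hN : IsSelfDual N) : IsSelfDual (M * N * M) := by
  unfold IsSelfDual at *
  rw [Matrix.transpose_mul, Matrix.transpose_mul, ← mul_assoc, hM, mul_assoc M, ← mul_assoc sympl,
    hN, mul_assoc N, hM]
  simp only [mul_assoc]

theorem IsSelfDual.inv {M : Matrix (V × Fin 2) (V × Fin 2) ℂ} (hM : IsSelfDual M)
    (h : M.det ≠ 0) : IsSelfDual M⁻¹ := by
  unfold IsSelfDual at *
  rw [Matrix.transpose_nonsing_inv]
  have h1 := h.isUnit
  have h2 : IsUnit M.transpose.det := by rwa [Matrix.det_transpose]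
  calc sympl * M.transpose⁻¹ = M⁻¹ * (M * sympl) * M.transpose⁻¹ := by
        rw [← mul_assoc, Matrix.nonsing_inv_mul _ h1, one_mul]
    _ = M⁻¹ * sympl * (M.transpose * M.transpose⁻¹) := by rw [← hM]; simp only [mul_assoc]
    _ = M⁻¹ * sympl := by rw [Matrix.mul_nonsing_inv _ h2, mul_one]

theorem isSelfDual_vertProj (S : Finset V) : IsSelfDual (vertProj S) := by
  unfold IsSelfDual
  ext a b
  rw [vertProj_mul_apply, vertProj, Matrix.diagonal_transpose, ← vertProj, mul_vertProj_apply]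
  by_cases h : a.1 = b.1
  · rw [h]
  · simp [sympl, h]

theorem isSelfDual_resolvent (hK : IsSelfDual K)
    (h : (1 - vertProj S * K * vertProj S).det ≠ 0) : IsSelfDual (resolvent K S) := by
  have : resolvent K S = vertProj S * (1 - vertProj S * K * vertProj S)⁻¹ * vertProj S := by
    rw [mul_assoc, ← resolvent_comm h, ← mul_assoc, vertProj_mul_self, resolvent]
  rw [this]
  exact (isSelfDual_vertProj S).conj (((isSelfDual_vertProj S).conj hK).one_sub.inv h)

/-- In dimension two, self-adjointness for the symplectic form kills the off-diagonal entries and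
equates the diagonal ones. This is why the determinant is a square. -/
theorem IsSelfDual.block {M : Matrix (V × Fin 2) (V × Fin 2) ℂ} (hM : IsSelfDual M) (v : V) :
    vertProj {v} * M * vertProj {v} = M (v, 0) (v, 0) • vertProj {v} := by
  have h00 := congrFun (congrFun hM (v, 0)) (v, 0)
  have h01 := congrFun (congrFun hM (v, 0)) (v, 1)
  have h11 := congrFun (congrFun hM (v, 1)) (v, 1)
  rw [sympl_mul_apply_zero, mul_sympl_apply_zero, Matrix.transpose_apply] at h00
  rw [sympl_mul_apply_zero, mul_sympl_apply_one, Matrix.transpose_apply] at h01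
  rw [sympl_mul_apply_one, mul_sympl_apply_one, Matrix.transpose_apply] at h11
  have e01 : M (v, 0) (v, 1) = 0 := by linear_combination h00 / 2
  have e10 : M (v, 1) (v, 0) = 0 := by linear_combination -h11 / 2
  ext ⟨a, i⟩ ⟨b, j⟩
  rw [mul_vertProj_apply, vertProj_mul_apply, Matrix.smul_apply, vertProj, Matrix.diagonal_apply]
  by_cases ha : a = v <;> by_cases hb : b = v
  · subst ha hb
    fin_cases i <;> fin_cases j <;> simp [e01, e10, h01]
  · subst ha
    simp [hb, Ne.symm hb]
  · subst hb
    simp [ha]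
  · simp [ha, hb]

/-- The scalar by which the elimination of the vertex `v` acts. -/
def pivot (K : Matrix (V × Fin 2) (V × Fin 2) ℂ) (S : Finset V) (v : V) : ℂ :=
  1 - (K * (1 + resolvent K S * K)) (v, 0) (v, 0)

/-- With `G` the resolvent, `K + KGK` is self-dual, so its block at `v` is scalar. The second part
lets the trace of that block be read as twice its corner entry. -/
theorem pivot_spec (hK : IsSelfDual K) (h : (1 - vertProj S * K * vertProj S).det ≠ 0) (v : V) :
    vertProj {v} * K * vertProj {v} + vertProj {v} * K * resolvent K S * K * vertProj {v} =
      (1 - pivot K S v) • vertProj {v} ∧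
    (K * (1 + resolvent K S * K)) (v, 0) (v, 0) = (K * (1 + resolvent K S * K)) (v, 1) (v, 1) := by
  have hT : IsSelfDual (K * (1 + resolvent K S * K)) := by
    rw [mul_add, mul_one, ← mul_assoc]
    exact hK.add (hK.conj (isSelfDual_resolvent hK h))
  constructor
  · have := hT.block v
    rw [pivot, sub_sub_cancel, ← this]
    simp only [mul_add, add_mul, mul_one, mul_assoc]
  · have h01 := congrFun (congrFun hT (v, 0)) (v, 1)
    rw [sympl_mul_apply_zero, mul_sympl_apply_one, Matrix.transpose_apply] at h01
    exact h01.symm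

/-- In `schur_factorization` the outer factors have determinant one, by `det (1 + AB) = det (1 +
BA)` with `BA = 0`. The middle one is the pivot on the two coordinates of `v`. -/
theorem det_insert (hK : IsSelfDual K) (h : (1 - vertProj S * K * vertProj S).det ≠ 0) {v : V}
    (hv : v ∉ S) :
    (1 - vertProj (insert v S) * K * vertProj (insert v S)).det =
      pivot K S v ^ 2 * (1 - vertProj S * K * vertProj S).det := by
  have hEP : vertProj {v} * vertProj S = 0 := by
    rw [vertProj_mul_vertProj, Finset.singleton_inter_of_notMem hv, vertProj_empty]
  have hPE : vertProj S * vertProj {v} = 0 := by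
    rw [vertProj_mul_vertProj, Finset.inter_singleton_of_notMem hv, vertProj_empty]
  have key := congrArg Matrix.det (schur_factorization (vertProj_mul_self {v}) hEP hPE
    vertProj_mul_resolvent (resolvent_mul_vertProj h) (resolvent_sub_right h)
    (resolvent_sub_left h) (pivot_spec hK h v).1)
  have hGE : resolvent K S * vertProj {v} = 0 := by
    rw [← resolvent_mul_vertProj h, mul_assoc, hPE, mul_zero]
  have hEG : vertProj {v} * resolvent K S = 0 := by
    rw [← vertProj_mul_resolvent, ← mul_assoc, hEP, zero_mul]
  have d1 : (1 + vertProj {v} * K * resolvent K S).det = 1 := by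
    rw [mul_assoc, Matrix.det_one_add_mul_comm, mul_assoc, hGE, mul_zero, add_zero, Matrix.det_one]
  have d2 : (1 - resolvent K S * K * vertProj {v}).det = 1 := by
    rw [Matrix.det_one_sub_mul_comm, ← mul_assoc, hEG, zero_mul, sub_zero, Matrix.det_one]
  have d3 : (1 - vertProj {v} + pivot K S v • vertProj {v}).det = pivot K S v ^ 2 := by
    have : 1 - vertProj {v} + pivot K S v • vertProj {v} =
        Matrix.diagonal fun a : V × Fin 2 => if a.1 = v then pivot K S v else 1 := by
      ext a b
      simp only [vertProj, Matrix.add_apply, Matrix.sub_apply, Matrix.smul_apply,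
        Matrix.diagonal_apply, Matrix.one_apply]
      by_cases hab : a = b
      · subst hab
        by_cases hav : a.1 = v <;> simp [hav]
      · simp [hab]
    rw [this, Matrix.det_diagonal, Fintype.prod_prod_type, Finset.prod_eq_single v]
    · simp
    · intro w _ hw
      simp [hw]
    · simp
  rw [Matrix.det_mul, Matrix.det_mul, Matrix.det_mul, d1, d2, d3, one_mul, mul_one] at key
  rw [vertProj_insert hv, key, mul_comm]

/-- This is `schur_row` multiplied by the inverse of the larger block. The row of the newly
eliminated vertex is all that the path recursion needs, and keeping the pivot on the left avoids
division. -/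
theorem vertProj_mul_resolvent_insert (hK : IsSelfDual K)
    (h : (1 - vertProj S * K * vertProj S).det ≠ 0) {v : V} (hv : v ∉ S)
    (h' : (1 - vertProj (insert v S) * K * vertProj (insert v S)).det ≠ 0) :
    pivot K S v • (vertProj {v} * resolvent K (insert v S)) =
      vertProj {v} * (1 + K * resolvent K S) := by
  have hEP : vertProj {v} * vertProj S = 0 := by
    rw [vertProj_mul_vertProj, Finset.singleton_inter_of_notMem hv, vertProj_empty]
  have hPE : vertProj S * vertProj {v} = 0 := by
    rw [vertProj_mul_vertProj, Finset.inter_singleton_of_notMem hv, vertProj_empty]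
  have key := schur_row (vertProj_mul_self {v}) hEP hPE (resolvent_mul_vertProj h)
    (resolvent_sub_right h) (pivot_spec hK h v).1
  have hGE : resolvent K S * vertProj {v} = 0 := by
    rw [← resolvent_mul_vertProj h, mul_assoc, hPE, mul_zero]
  rw [← vertProj_insert hv] at key
  have hYP : (vertProj {v} + vertProj {v} * K * resolvent K S) * vertProj (insert v S) =
      vertProj {v} + vertProj {v} * K * resolvent K S := by
    rw [vertProj_insert hv]
    simp only [add_mul, mul_add, mul_assoc, hEP, vertProj_mul_self, resolvent_mul_vertProj h, hGE,
      mul_zero, add_zero, zero_add]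
    exact add_comm _ _
  have key2 := congrArg (· * (1 - vertProj (insert v S) * K * vertProj (insert v S))⁻¹ *
    vertProj (insert v S)) key
  rw [mul_assoc (vertProj {v} + _), Matrix.mul_nonsing_inv _ h'.isUnit, mul_one, hYP, mul_assoc (_ • _),
    ← resolvent_comm h', ← resolvent, smul_mul_assoc] at key2
  rw [← key2, mul_add, mul_one, mul_assoc]

end Resolvent

/-! ### The determinant as the square of the cycle polynomial. -/

section Determinant

variable {V E : Type*} {Γ : OrientedGraph V E}

variable (Γ) in
/-- The matrix element of `M` between the reversed spinor of `b` and the spinor `y` at `u`. -/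
def sandwich (z : SpinorData E) (M : Matrix (V × Fin 2) (V × Fin 2) ℂ) (u : V) (y : Spinor)
    (b : DirEdge E) : ℂ :=
  ∑ i, ∑ j, ![z b.rev 1, -z b.rev 0] i * M (Γ.finish b, i) (u, j) * y j

theorem sandwich_add (z : SpinorData E) (M N : Matrix (V × Fin 2) (V × Fin 2) ℂ) (u : V)
    (y : Spinor) (b : DirEdge E) :
    Γ.sandwich z (M + N) u y b = Γ.sandwich z M u y b + Γ.sandwich z N u y b := by
  simp only [sandwich, Matrix.add_apply, ← Finset.sum_add_distrib]
  exact Finset.sum_congr rfl fun _ _ => Finset.sum_congr rfl fun _ _ => by ring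

theorem sandwich_smul (z : SpinorData E) (c : ℂ) (M : Matrix (V × Fin 2) (V × Fin 2) ℂ) (u : V)
    (y : Spinor) (b : DirEdge E) :
    Γ.sandwich z (c • M) u y b = c * Γ.sandwich z M u y b := by
  simp only [sandwich, Matrix.smul_apply, Finset.mul_sum, smul_eq_mul]
  exact Finset.sum_congr rfl fun _ _ => Finset.sum_congr rfl fun _ _ => by ring

theorem sandwich_one (z : SpinorData E) (u : V) (y : Spinor) (b : DirEdge E) :
    Γ.sandwich z 1 u y b = if Γ.finish b = u then bracket y (z b.rev) else 0 := by
  unfold sandwich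
  split_ifs with h
  · simp [Fin.sum_univ_two, Matrix.one_apply, h, bracket]
    ring
  · simp [h]

variable [Fintype V]

theorem sandwich_vertProj_mul (z : SpinorData E) (S : Finset V)
    (M : Matrix (V × Fin 2) (V × Fin 2) ℂ) (u : V) (y : Spinor) (b : DirEdge E) :
    Γ.sandwich z (vertProj S * M) u y b = if Γ.finish b ∈ S then Γ.sandwich z M u y b else 0 := by
  simp only [sandwich, vertProj_mul_apply]
  split_ifs <;> simp

/-- Symplectic transposition exchanges an edge with its reverse; the sign in `dirKernel` compensates
the antisymmetry of the form. -/
theorem sympl_mul_transpose_dirKernel (z : SpinorData E) (d : DirEdge E) :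
    sympl * (Γ.dirKernel z d).transpose = Γ.dirKernel z d.rev * sympl := by
  have hrr : d.rev.rev = d := by simp [DirEdge.rev]
  have hd2 : d.rev.2 = !d.2 := rfl
  ext ⟨a, i⟩ ⟨b, j⟩
  fin_cases i <;> fin_cases j <;>
    simp only [Fin.zero_eta, Fin.mk_one, sympl_mul_apply_zero, sympl_mul_apply_one,
      mul_sympl_apply_zero, mul_sympl_apply_one, Matrix.transpose_apply, dirKernel, start_rev,
      finish_rev, hrr, hd2] <;>
    by_cases h1 : Γ.start d = b <;> by_cases h2 : Γ.finish d = a <;>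
    cases d.2 <;> simp [h1, h2] <;> ring

variable [Fintype E]

theorem isSelfDual_kernelOn (z : SpinorData E) : IsSelfDual (Γ.kernelOn z Finset.univ) := by
  unfold IsSelfDual kernelOn
  rw [Matrix.transpose_sum, Finset.mul_sum, Finset.sum_mul]
  simp only [sympl_mul_transpose_dirKernel]
  have hinv : Function.Involutive (DirEdge.rev : DirEdge E → DirEdge E) := fun d => by
    simp [DirEdge.rev]
  exact Equiv.sum_comp hinv.toPerm fun d => Γ.dirKernel z d * sympl

/-- Restricting to `S` amounts to deleting directed edges, so smallness also makes every restricted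
block invertible. -/
theorem vertProj_kernelOn (z : SpinorData E) (S : Finset V) :
    vertProj S * Γ.kernelOn z Finset.univ * vertProj S =
      Γ.kernelOn z (Finset.univ.filter fun d => Γ.start d ∈ S ∧ Γ.finish d ∈ S) := by
  unfold kernelOn
  rw [Finset.mul_sum, Finset.sum_mul, Finset.sum_filter]
  refine Finset.sum_congr rfl fun d _ => ?_
  ext a b
  rw [mul_vertProj_apply, vertProj_mul_apply]
  by_cases h : Γ.start d = a.1 ∧ Γ.finish d = b.1
  · rw [h.1, h.2]
    by_cases h1 : a.1 ∈ S <;> by_cases h2 : b.1 ∈ S <;> simp [h1, h2]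
  · have h0 : Γ.dirKernel z d a b = 0 := by simp only [dirKernel, if_neg h]
    split_ifs <;> simp [h0]

theorem IsSmall.det_ne_zero {z : SpinorData E} (hz : Γ.IsSmall z) (S : Finset V) :
    (1 - vertProj S * Γ.kernelOn z Finset.univ * vertProj S).det ≠ 0 := by
  rw [vertProj_kernelOn]
  exact det_one_sub_ne_zero_of_hermForm_le (hz.norm_hermForm_kernelOn _)

theorem kernelOn_mul_apply (z : SpinorData E) (M : Matrix (V × Fin 2) (V × Fin 2) ℂ) (v : V)
    (i : Fin 2) (c : V × Fin 2) :
    (Γ.kernelOn z Finset.univ * M) (v, i) c = ∑ d with Γ.start d = v,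
      dirSign d * z d i * ∑ k, ![z d.rev 1, -z d.rev 0] k * M (Γ.finish d, k) c := by
  unfold kernelOn
  rw [Finset.sum_mul, Matrix.sum_apply, Finset.sum_filter]
  refine Finset.sum_congr rfl fun d _ => ?_
  rw [Matrix.mul_apply, Fintype.sum_prod_type, Finset.sum_eq_single (Γ.finish d)]
  · by_cases h : Γ.start d = v
    · simp only [dirKernel, h, and_self, if_true, dirSign, Finset.mul_sum]
      exact Finset.sum_congr rfl fun k _ => by ring
    · simp [dirKernel, h]
  · intro w _ hw
    simp [dirKernel, Ne.symm hw]
  · simp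

theorem sandwich_kernelOn_mul (z : SpinorData E) (M : Matrix (V × Fin 2) (V × Fin 2) ℂ) (u : V)
    (y : Spinor) (b : DirEdge E) :
    Γ.sandwich z (Γ.kernelOn z Finset.univ * M) u y b = ∑ d with Γ.start d = Γ.finish b,
      dirSign d * bracket (z d) (z b.rev) * Γ.sandwich z M u y d := by
  unfold sandwich
  simp only [kernelOn_mul_apply, Fin.sum_univ_two, Finset.mul_sum, Finset.sum_mul,
    ← Finset.sum_add_distrib]
  refine Finset.sum_congr rfl fun d _ => ?_
  simp [bracket]
  ring

theorem trace_kernelOn_mul (z : SpinorData E) (M : Matrix (V × Fin 2) (V × Fin 2) ℂ) (v : V) :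
    ∑ i, (Γ.kernelOn z Finset.univ * M) (v, i) (v, i) = ∑ d with Γ.start d = v,
      dirSign d * Γ.sandwich z M v (z d) d := by
  unfold sandwich
  simp only [kernelOn_mul_apply, Fin.sum_univ_two, ← Finset.sum_add_distrib]
  refine Finset.sum_congr rfl fun d _ => ?_
  simp
  ring

/-- The closed paths at `v` sum to `D_S` times the trace of the block of `K + KGK` at `v`, which is
`2 (1 - pivot)`. Its factor `2` cancels the two directions of each cycle. -/
theorem cyclePolyOn_insert_eq_pivot_mul {z : SpinorData E} (hz : Γ.IsSmall z) {S : Finset V} {v : V}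
    (hv : v ∉ S)
    (hS : ∀ u ∉ S, ∀ y b, Γ.pathSum z u S y b = Γ.cyclePolyOn z S *
      Γ.sandwich z (1 + resolvent (Γ.kernelOn z Finset.univ) S * Γ.kernelOn z Finset.univ) u y b) :
    Γ.cyclePolyOn z (insert v S) =
      pivot (Γ.kernelOn z Finset.univ) S v * Γ.cyclePolyOn z S := by
  have h1 := two_mul_cyclePolyOn_insert (Γ := Γ) z hv
  simp only [hS v hv] at h1
  have h2 := trace_kernelOn_mul (Γ := Γ) z
    (1 + resolvent (Γ.kernelOn z Finset.univ) S * Γ.kernelOn z Finset.univ) v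
  rw [Fin.sum_univ_two, ← (pivot_spec (isSelfDual_kernelOn z) (hz.det_ne_zero S) v).2] at h2
  have h3 : ∑ d with Γ.start d = v, dirSign d * (Γ.cyclePolyOn z S * Γ.sandwich z
      (1 + resolvent (Γ.kernelOn z Finset.univ) S * Γ.kernelOn z Finset.univ) v (z d) d) =
      Γ.cyclePolyOn z S * ∑ d with Γ.start d = v, dirSign d * Γ.sandwich z
      (1 + resolvent (Γ.kernelOn z Finset.univ) S * Γ.kernelOn z Finset.univ) v (z d) d := by
    rw [Finset.mul_sum]
    exact Finset.sum_congr rfl fun _ _ => by ring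
  rw [h3, ← h2] at h1
  rw [pivot]
  linear_combination h1 / 2

/-- Path sums are matrix elements of the resolvent. -/
theorem pathSum_eq_sandwich {z : SpinorData E} (hz : Γ.IsSmall z) (n : ℕ) :
    ∀ S : Finset V, S.card = n → ∀ u ∉ S, ∀ y b, Γ.pathSum z u S y b = Γ.cyclePolyOn z S *
      Γ.sandwich z (1 + resolvent (Γ.kernelOn z Finset.univ) S * Γ.kernelOn z Finset.univ) u y b := by
  induction n with
  | zero =>
    intro S hS u hu y b
    rw [Finset.card_eq_zero] at hS
    subst hS
    rw [resolvent, vertProj_empty, zero_mul, zero_mul, add_zero, sandwich_one]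
    split_ifs with h
    · rw [pathSum_of_finish_eq z _ _ h, mul_comm]
    · rw [pathSum_of_notMem z _ _ h (by simp), mul_zero]
  | succ n ih =>
    intro S hS u hu y b
    by_cases h1 : Γ.finish b ∈ S
    · have h2 : Γ.finish b ≠ u := fun h => hu (h ▸ h1)
      -- The order of elimination is free: the vertex at which `b` ends is taken to be the last one
      -- eliminated.
      obtain ⟨v, hv⟩ : ∃ v, v = Γ.finish b := ⟨_, rfl⟩
      rw [← hv] at h1 h2
      obtain ⟨T, hT⟩ : ∃ T, T = S.erase v := ⟨_, rfl⟩
      have hvT : v ∉ T := by simp [hT]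
      have hST : S = insert v T := by rw [hT, Finset.insert_erase h1]
      have huT : u ∉ T := fun h => hu (by rw [hST]; exact Finset.mem_insert_of_mem h)
      have hTn : T.card = n := by rw [hT, Finset.card_erase_of_mem h1, hS]; rfl
      have hc := cyclePolyOn_insert_eq_pivot_mul hz hvT (ih T hTn)
      have hrow := vertProj_mul_resolvent_insert (isSelfDual_kernelOn z) (hz.det_ne_zero T) hvT
        (hz.det_ne_zero (insert v T))
      rw [pathSum_of_mem z S y (hv ▸ h2) (hv ▸ h1), ← hv, ← hT]
      simp only [ih T hTn u huT]
      rw [sandwich_add, sandwich_one, if_neg (hv ▸ h2), zero_add, hST, hc]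
      have h3 : Γ.sandwich z (resolvent (Γ.kernelOn z Finset.univ) (insert v T) *
          Γ.kernelOn z Finset.univ) u y b = Γ.sandwich z (vertProj {v} *
          resolvent (Γ.kernelOn z Finset.univ) (insert v T) * Γ.kernelOn z Finset.univ) u y b := by
        rw [mul_assoc, sandwich_vertProj_mul, if_pos (by simp [hv])]
      -- The pivot in `D_S = pivot * D_T` is exactly the one required by the row formula, which then
      -- expresses the row through `T` alone.
      rw [h3, mul_comm (pivot _ _ _), mul_assoc, ← sandwich_smul, ← smul_mul_assoc, hrow,
        mul_assoc (vertProj {v}), sandwich_vertProj_mul, if_pos (by simp [hv]), add_mul, one_mul,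
        mul_assoc (Γ.kernelOn z Finset.univ)]
      have h4 : Γ.kernelOn z Finset.univ + Γ.kernelOn z Finset.univ *
          (resolvent (Γ.kernelOn z Finset.univ) T * Γ.kernelOn z Finset.univ) =
          Γ.kernelOn z Finset.univ * (1 + resolvent (Γ.kernelOn z Finset.univ) T *
            Γ.kernelOn z Finset.univ) := by
        rw [mul_add, mul_one]
      rw [h4, sandwich_kernelOn_mul, Finset.mul_sum, ← hv]
      exact Finset.sum_congr rfl fun d _ => by ring
    · rw [← vertProj_mul_resolvent, mul_assoc, sandwich_add, sandwich_vertProj_mul, if_neg h1,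
        add_zero, sandwich_one]
      split_ifs with h
      · rw [pathSum_of_finish_eq z _ _ h, mul_comm]
      · rw [pathSum_of_notMem z _ _ h h1, mul_zero]

/-- Adding a vertex multiplies both sides by the squared pivot. -/
theorem IsSmall.cyclePolyOn_sq {z : SpinorData E} (hz : Γ.IsSmall z) (S : Finset V) :
    Γ.cyclePolyOn z S ^ 2 = (1 - vertProj S * Γ.kernelOn z Finset.univ * vertProj S).det := by
  induction S using Finset.induction_on with
  | empty => simp [cyclePolyOn_empty, vertProj_empty]
  | insert v S hv ih =>
    rw [cyclePolyOn_insert_eq_pivot_mul hz hv (pathSum_eq_sandwich hz _ S rfl),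
      det_insert (isSelfDual_kernelOn z) (hz.det_ne_zero S) hv, ← ih, mul_pow]

theorem IsSmall.cyclePoly_sq {z : SpinorData E} (hz : Γ.IsSmall z) :
    Γ.cyclePoly z ^ 2 = (1 - Γ.kernelOn z Finset.univ).det := by
  rw [← cyclePolyOn_univ, hz.cyclePolyOn_sq, vertProj_univ, one_mul, mul_one]

theorem IsSmall.cyclePoly_ne_zero {z : SpinorData E} (hz : Γ.IsSmall z) : Γ.cyclePoly z ≠ 0 := by
  intro h
  have h1 := hz.det_ne_zero Finset.univ
  rw [vertProj_univ, one_mul, mul_one, ← hz.cyclePoly_sq, h] at h1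
  simp at h1

theorem IsSmall.hasSum_genTerm_cyclePoly {z : SpinorData E} (hz : Γ.IsSmall z) :
    HasSum (Γ.genTerm z) (1 / Γ.cyclePoly z ^ 2) := by
  rw [hz.cyclePoly_sq]
  exact hz.hasSum_genTerm

end Determinant


/-! ### Analytic continuation from small spinors. -/

section Continuation

variable {V E : Type*}

section

variable {Γ : OrientedGraph V E} [Fintype E]

theorem analyticAt_listAmp (l : List (DirEdge E)) (z : SpinorData E) :
    AnalyticAt ℂ (fun z : SpinorData E => listAmp z l) z := by
  have hcoord : ∀ d i, AnalyticAt ℂ (fun z : SpinorData E => z d i) z := fun d i =>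
    ((ContinuousLinearMap.proj (R := ℂ) (φ := fun _ : Fin 2 => ℂ) i).comp
      (ContinuousLinearMap.proj (R := ℂ) (φ := fun _ : DirEdge E => Spinor) d)).analyticAt z
  have h : ∀ l l' : List (DirEdge E), AnalyticAt ℂ (fun z : SpinorData E =>
      (List.zipWith (fun d d' => bracket (z d.rev) (z d')) l l').prod) z := by
    intro l
    induction l with
    | nil =>
      intro l'
      simpa using analyticAt_const
    | cons a l ih =>
      intro l'
      cases l' with
      | nil => simpa using analyticAt_const
      | cons b l' =>
        simp only [List.zipWith_cons_cons, List.prod_cons]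
        refine AnalyticAt.mul ?_ (ih l')
        unfold bracket
        exact ((hcoord _ _).mul (hcoord _ _)).sub ((hcoord _ _).mul (hcoord _ _))
  unfold listAmp
  exact analyticAt_const.mul (h _ _)

theorem analyticAt_cyclePoly (z : SpinorData E) : AnalyticAt ℂ Γ.cyclePoly z := by
  have h : ∀ c : Γ.NontrivialCycle, AnalyticAt ℂ (fun z => cycleAmp z c) z := by
    intro c
    induction c using Quotient.inductionOn with
    | h l => exact analyticAt_listAmp l.1 z
  unfold cyclePoly unionAmp
  exact analyticAt_const.add (Finset.analyticAt_fun_sum _ fun C _ =>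
    Finset.analyticAt_fun_prod _ fun c _ => h c)

end

variable [Fintype V] [Fintype E] {Γ : OrientedGraph V E}

theorem genTerm_smul (t : ℂ) (z : SpinorData E) (n : E → ℕ) :
    Γ.genTerm (t • z) n = t ^ (2 * ∑ e, n e) * Γ.genTerm z n := by
  have hb : ∀ (e : E) (g : SU2), bracketAct ((t • z) (e, true)) g ((t • z) (e, false)) =
      t ^ 2 * bracketAct (z (e, true)) g (z (e, false)) := by
    intro e g
    simp only [bracketAct, bracket, Pi.smul_apply, Matrix.mulVec_smul, smul_eq_mul]
    ring
  have ha : Γ.amplitude n (t • z) = t ^ (2 * ∑ e, n e) * Γ.amplitude n z := by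
    unfold amplitude
    rw [← integral_const_mul]
    congr 1
    ext g
    simp only [hb, mul_pow, mul_div_assoc, Finset.prod_mul_distrib]
    rw [Finset.prod_pow_eq_pow_sum, ← pow_mul]
  rw [genTerm, ha, genTerm]
  ring

theorem eventually_isSmall : ∀ᶠ z : SpinorData E in nhds 0, Γ.IsSmall z := by
  obtain ⟨ε, hε, h⟩ := Γ.exists_isSmall
  filter_upwards [Metric.ball_mem_nhds 0 hε] with z hz
  exact h z fun d => (norm_le_pi_norm z d).trans_lt (mem_ball_zero_iff.mp hz)

/-- Wherever the series converges absolutely, its sum is the inverse square of the polynomial. -/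
theorem genFunctional_mul_cyclePoly_sq {z : SpinorData E} (hz : Summable (Γ.genTerm z)) :
    Γ.genFunctional z * Γ.cyclePoly z ^ 2 = 1 := by
  -- On the complex line through `z` the series becomes a sum of monomials in `t`, dominated on the
  -- closed unit disc by its absolutely convergent value at `t = 1`.
  set f : ℂ → ℂ := fun t => ∑' n : E → ℕ, t ^ (2 * ∑ e, n e) * Γ.genTerm z n with hf
  set p : ℂ → ℂ := fun t => Γ.cyclePoly (t • z) with hp
  have hline : Differentiable ℂ fun t : ℂ => t • z := by fun_prop
  have hpd : Differentiable ℂ p := by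
    have hc : Differentiable ℂ Γ.cyclePoly := fun w =>
      (analyticAt_cyclePoly w).differentiableAt
    exact hc.comp hline
  have hle : ∀ (n : E → ℕ) (t : ℂ), ‖t‖ ≤ 1 →
      ‖t ^ (2 * ∑ e, n e) * Γ.genTerm z n‖ ≤ ‖Γ.genTerm z n‖ := fun n t ht => by
    rw [norm_mul, norm_pow]
    exact mul_le_of_le_one_left (norm_nonneg _) (pow_le_one₀ (norm_nonneg _) ht)
  have hfd : DifferentiableOn ℂ f (Metric.ball 0 1) :=
    Complex.differentiableOn_tsum_of_summable_norm hz.norm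
      (fun n => (by fun_prop : Differentiable ℂ fun t : ℂ =>
        t ^ (2 * ∑ e, n e) * Γ.genTerm z n).differentiableOn) Metric.isOpen_ball
      fun n t ht => hle n t (mem_ball_zero_iff.mp ht).le
  have hfc : ContinuousOn f (Metric.closedBall 0 1) :=
    continuousOn_tsum (fun n => (by fun_prop : Continuous fun t : ℂ =>
        t ^ (2 * ∑ e, n e) * Γ.genTerm z n).continuousOn) hz.norm
      fun n t ht => hle n t (mem_closedBall_zero_iff.mp ht)
  have hev : (fun t => f t * p t ^ 2) =ᶠ[nhds 0] fun _ => 1 := by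
    have h0 : Filter.Tendsto (fun t : ℂ => t • z) (nhds 0) (nhds 0) := by
      have := hline.continuous.tendsto 0
      rwa [zero_smul] at this
    filter_upwards [h0.eventually (eventually_isSmall (Γ := Γ))] with t ht
    have h1 : f t = 1 / p t ^ 2 := by
      rw [← ht.hasSum_genTerm_cyclePoly.tsum_eq]
      simp only [hf, genTerm_smul]
    have h2 : p t ≠ 0 := ht.cyclePoly_ne_zero
    rw [h1, one_div, inv_mul_cancel₀ (pow_ne_zero 2 h2)]
  have hball : Set.EqOn (fun t => f t * p t ^ 2) (fun _ => 1) (Metric.ball 0 1) :=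
    AnalyticOnNhd.eqOn_of_preconnected_of_eventuallyEq (z₀ := 0)
      ((hfd.mul (hpd.pow 2).differentiableOn).analyticOnNhd Metric.isOpen_ball)
      analyticOnNhd_const (convex_ball (0 : ℂ) 1).isPreconnected (by simp) hev
  -- The point `t = 1` lies on the boundary of the disc of analyticity and is reached by continuity.
  have hclosed : Set.EqOn (fun t => f t * p t ^ 2) (fun _ => 1) (Metric.closedBall 0 1) :=
    hball.of_subset_closure (hfc.mul (hpd.continuous.pow 2).continuousOn) continuousOn_const
      Metric.ball_subset_closedBall (closure_ball (0 : ℂ) one_ne_zero).ge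
  have h1 := hclosed (x := 1) (by simp)
  simpa [hf, hp, genFunctional] using h1

/-- The identity theorem is applied to `F · D²`, which is analytic on `U` whether or not `D`
vanishes; that `D` has no zeros on `U` is then a consequence. -/
theorem continuation_mul_cyclePoly_sq {U : Set (SpinorData E)} {F : SpinorData E → ℂ}
    (hU : IsPreconnected U) (h0 : 0 ∈ U) (hF : AnalyticOnNhd ℂ F U)
    (hev : F =ᶠ[nhds 0] Γ.genFunctional) {z : SpinorData E} (hz : z ∈ U) :
    F z * Γ.cyclePoly z ^ 2 = 1 := by
  have h1 : (fun z => F z * Γ.cyclePoly z ^ 2) =ᶠ[nhds 0] fun _ => 1 := by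
    filter_upwards [hev, eventually_isSmall (Γ := Γ)] with w hw hs
    rw [hw, genFunctional_mul_cyclePoly_sq hs.hasSum_genTerm.summable]
  exact AnalyticOnNhd.eqOn_of_preconnected_of_eventuallyEq
    (f := fun z => F z * Γ.cyclePoly z ^ 2) (g := fun _ => 1)
    (fun w hw => (hF w hw).mul ((analyticAt_cyclePoly w).pow 2)) analyticOnNhd_const hU h0 h1 hz

end Continuation

end SpinNetwork.OrientedGraph

end

theorem mainTheorem1 {V E : Type*} [Fintype V] [Fintype E] (Γ : SpinNetwork.OrientedGraph V E) :
    -- the defining series converges absolutely for all sufficiently small spinors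
    (∃ ε : ℝ, 0 < ε ∧ ∀ z : SpinNetwork.SpinorData E, (∀ d, ‖z d‖ < ε) →
      Summable (Γ.genTerm z)) ∧
    -- wherever it converges absolutely, its sum is the claimed one
    (∀ z : SpinNetwork.SpinorData E, Summable (Γ.genTerm z) →
      Γ.cyclePoly z ≠ 0 ∧ Γ.genFunctional z = 1 / (Γ.cyclePoly z) ^ 2) ∧
    -- every analytic continuation of the sum from a neighbourhood of zero is the claimed one
    (∀ (U : Set (SpinNetwork.SpinorData E)) (F : SpinNetwork.SpinorData E → ℂ),
      IsOpen U → IsPreconnected U → 0 ∈ U → AnalyticOnNhd ℂ F U →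
      F =ᶠ[nhds 0] Γ.genFunctional →
      ∀ z ∈ U, Γ.cyclePoly z ≠ 0 ∧ F z = 1 / (Γ.cyclePoly z) ^ 2) := by
  have key : ∀ a b : ℂ, a * b ^ 2 = 1 → b ≠ 0 ∧ a = 1 / b ^ 2 := by
    intro a b h
    have hb : b ≠ 0 := by
      rintro rfl
      simp at h
    exact ⟨hb, by rw [eq_div_iff (pow_ne_zero 2 hb), h]⟩
  obtain ⟨ε, hε, hsmall⟩ := Γ.exists_isSmall
  exact ⟨⟨ε, hε, fun z hz => (hsmall z hz).hasSum_genTerm.summable⟩,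
    fun z hz => key _ _ (SpinNetwork.OrientedGraph.genFunctional_mul_cyclePoly_sq hz),
    fun U F _ hU h0 hF hev z hz => key _ _
      (SpinNetwork.OrientedGraph.continuation_mul_cyclePoly_sq hU h0 hF hev hz)⟩
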